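/- **Model.** Fix integers $B\ge 1$, $\Delta^{\max}\ge 1$ and $p,\lambda\in[0,1]$. A sensor has a battery of capacity $B$. The system state in a slot $t=1,2,\dots$ is $s=(b,r,\Delta,\tilde b)$ with battery level $b\in\{0,\dots,B\}$, request indicator $r\in\{0,1\}$, age of information $\Delta\in\{1,\dots,\Delta^{\max}\}$ and last reported battery level $\tilde b\in\{1,\dots,B\}$. The controller observes $o=(r,\Delta,\tilde b)$ but not $b$, and chooses an action $a\in\{0,1\}$. Put $d=a\,\mathbf 1_{\{b\ge1\}}$. The cost of the slot is $\Delta^{\mathrm{OD}}=r\min\{(1-d)\Delta+1,\Delta^{\max}\}$, and the next state is $b'=\min\{b+e-d,B\}$; $(\Delta',\tilde b')=(1,b)$ if $d=1$ and $(\Delta',\tilde b')=(\min\{\Delta+1,\Delta^{\max}\},\tilde b)$ if $d=0$; and $r'$. Here $e$ and $r'$ are Bernoulli variables with parameters $\lambda$ and $p$, independent of each other and of the past. A belief is a probability vector $\beta=(\beta_0,\dots,\beta_B)$; a belief-state is $z=(\beta,r,\Delta,\tilde b)$. Starting from the initial belief-state $z_0=(\beta,o)$ means that the initial observation is $o$ and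 the initial battery level has law $\beta$; afterwards the belief in a slot is the conditional law of the battery level given all observations and actions so far. A policy on belief-states is a map $\pi$ from belief-states to $\{0,1\}$; more generally a history-dependent policy chooses each action as a function of all observations so far. The average cost is $\bar C_\pi(z_0)=\lim_{T\to\infty}\frac1T\sum_{t=1}^T\mathbb E_\pi[\Delta^{\mathrm{OD}}(t)\mid z_0]$. Let $\Lambda$ be the $(B+1)\times(B+1)$ matrix with $\Lambda_{jj}=1-\lambda$ and $\Lambda_{j+1,j}=\lambda$ for $0\le j<B$, $\Lambda_{BB}=1$, and all other entries $0$. For $1\le j\le B$ let $\rho^j$ be the vector with entries $1-\lambda$ at position $j-1$, $\lambda$ at position $j$, and $0$ elsewhere, and let $\rho^0=\rho^1$. A belief space is a set $\mathcal B$ of probability vectors on $\{0,\dots,B\}$ that contains $\rho^0,\dots,\rho^B$ and satisfies $\Lambda\mathcal B\subseteq\mathcal B$ (for example all probability vectors, or all $\Lambda^m\beta$ and $\Lambda^m\rho^j$ for a given initial belief $\beta$); then $\mathcal Z=\mathcal B\times\{0,1\}\times\{1,\dots,\Delta^{\max}\}\times\{1,\dots,B\}$. For a real function $h$ of the belief-state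 put $$Q(z,0)=r\min\{\Delta+1,\Delta^{\max}\}+\sum_{r'=0}^1[r'p+(1-r')(1-p)]\,h(\Lambda\beta,r',\min\{\Delta+1,\Delta^{\max}\},\tilde b),$$ $$Q(z,1)=r\beta_0\min\{\Delta+1,\Delta^{\max}\}+r(1-\beta_0)+\beta_0\sum_{r'=0}^1[r'p+(1-r')(1-p)]\,h(\rho^0,r',\min\{\Delta+1,\Delta^{\max}\},\tilde b)+\sum_{j=1}^B\beta_j\big[p\,h(\rho^j,1,1,j)+(1-p)\,h(\rho^j,0,1,j)\big].$$ **Theorem.** (i) If $\Delta^{\max}\ge2$, then for every function $h$, every belief-state $z$ and every $a\in\{0,1\}$, $Q(z,a)$ is the action-value of the belief-state MDP: $Q(z,a)=\mathbb E[\Delta^{\mathrm{OD}}\mid z,a]+\sum_{o'}\Pr(o'\mid z,a)\,h(z')$, where $z'$ consists of the next observation $o'$ and the belief obtained from $\beta$, $a$, $o'$ by Bayes' rule. (ii) There is a constant $\bar C^*$, independent of the initial belief-state and of the belief space, such that for every belief space $\mathcal B$ there is a function $h$, bounded on $\mathcal Z$, with $$\bar C^*+h(z)=\min_{a\in\{0,1\}}Q(z,a),\qquad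 z\in\mathcal Z.$$ (iii) Let $\mathcal B$ be a belief space, and let a constant $C$ and a function $h$, bounded on $\mathcal Z$, satisfy $C+h(z)=\min_aQ(z,a)$ for all $z\in\mathcal Z$. Then $C=\bar C^*$, and every policy $\pi^*$ with $\pi^*(z)\in\arg\min_{a}Q(z,a)$ for all $z\in\mathcal Z$ is optimal from every initial belief-state $z_0\in\mathcal Z$ with optimal average cost $\bar C^*$: the limit $\bar C_{\pi^*}(z_0)$ exists and equals $\bar C^*$, and for every history-dependent policy $g$ (in particular for every policy on belief-states), $\liminf_{T\to\infty}\frac1T\sum_{t=1}^T\mathbb E_g[\Delta^{\mathrm{OD}}(t)\mid z_0]\ge\bar C^*$. -/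

import Mathlib

open Filter Topology

namespace AoI

noncomputable section

/-! Throughout, `B` is the battery capacity, `D` the cap on the age of information,
`p` the request probability and `lam` the energy arrival probability. -/

/-- Observable part `(r, Δ, b̃)` of the state, with `r ∈ {0,1}`, `Δ ∈ {1,…,D}`, `b̃ ∈ {1,…,B}`. -/
abbrev Obs (B D : ℕ) : Type := Fin 2 × Set.Icc 1 D × Set.Icc 1 B

/-- System state `(b, r, Δ, b̃)`, with battery level `b ∈ {0,…,B}`. -/
abbrev State (B D : ℕ) : Type := Fin (B + 1) × Obs B D

/-- Commands of the edge node: `1` is "send an update", `0` is "do not send". -/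
abbrev Action : Type := Fin 2

/-- Vectors `(β_0,…,β_B)`. -/
abbrev Belief (B : ℕ) : Type := Fin (B + 1) → ℝ

/-- Belief-states `z = (β, r, Δ, b̃)`. -/
abbrev BeliefState (B D : ℕ) : Type := Belief B × Obs B D

/-- The AoI `min {Δ + 1, D}`. -/
def ageStep {D : ℕ} (x : Set.Icc 1 D) : Set.Icc 1 D :=
  ⟨min (x.1 + 1) D, by have := x.2.1; have := x.2.2; constructor <;> omega⟩

/-- The AoI `1`, available as soon as `{1,…,D}` is nonempty. -/
def ageOne {D : ℕ} (x : Set.Icc 1 D) : Set.Icc 1 D :=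
  ⟨1, le_rfl, x.2.1.trans x.2.2⟩

/-- A battery level `j ∈ {1,…,B}` as an element of `{0,…,B}`. -/
def level {B : ℕ} (j : Set.Icc 1 B) : Fin (B + 1) := ⟨j.1, Nat.lt_succ_of_le j.2.2⟩

/-! ### The partially observed system -/

/-- `Pr(r')`. -/
def requestProb (p : ℝ) (r' : Fin 2) : ℝ := if r' = 1 then p else 1 - p

/-- `Pr(b' | b, a)`. -/
def batteryProb {B : ℕ} (lam : ℝ) (b : Fin (B + 1)) (a : Action) (b' : Fin (B + 1)) : ℝ :=
  if a = 0 then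
    if b.1 = B then (if b'.1 = B then 1 else 0)
    else if b'.1 = b.1 + 1 then lam else if b'.1 = b.1 then 1 - lam else 0
  else
    if b.1 = 0 then (if b'.1 = 1 then lam else if b'.1 = 0 then 1 - lam else 0)
    else if b'.1 = b.1 then lam else if b'.1 + 1 = b.1 then 1 - lam else 0

/-- `Pr(Δ', b̃' | b, b̃, Δ, a)`: an update carrying the level `b` is received iff `a = 1` and
`b ≥ 1`. -/
def knowledgeProb {B D : ℕ} (b : Fin (B + 1)) (x : Set.Icc 1 D) (k : Set.Icc 1 B) (a : Action)
    (x' : Set.Icc 1 D) (k' : Set.Icc 1 B) : ℝ :=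
  if a = 1 ∧ 1 ≤ b.1 then (if x'.1 = 1 ∧ k'.1 = b.1 then 1 else 0)
  else (if x' = ageStep x ∧ k' = k then 1 else 0)

/-- The transition function `Pr(s' | s, a)`. -/
def transProb {B D : ℕ} (p lam : ℝ) (s : State B D) (a : Action) (s' : State B D) : ℝ :=
  requestProb p s'.2.1 * batteryProb lam s.1 a s'.1 *
    knowledgeProb s.1 s.2.2.1 s.2.2.2 a s'.2.2.1 s'.2.2.2

/-- On-demand AoI `r · min {(1 - d) Δ + 1, D}` with `d = a · 1{b ≥ 1}`. -/
def cost {B D : ℕ} (s : State B D) (a : Action) : ℝ :=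
  ((s.2.1 : ℕ) : ℝ) *
    min ((1 - (if a = 1 ∧ 1 ≤ s.1.1 then 1 else 0)) * ((s.2.2.1.1 : ℕ) : ℝ) + 1) (D : ℝ)

/-- State trajectories over the first `t + 1` slots. -/
abbrev Traj (B D t : ℕ) : Type := Fin (t + 1) → State B D

/-- The observations along a trajectory. -/
def observe {B D t : ℕ} (s : Traj B D t) : Fin (t + 1) → Obs B D := fun i => (s i).2

/-- History-dependent policies: the action in each slot is a function of all observations so far
(and hence of all earlier actions as well, these being functions of earlier observations). -/
abbrev Policy (B D : ℕ) : Type := ∀ t : ℕ, (Fin (t + 1) → Obs B D) → Action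

/-- The initial distribution over states given by a belief-state. -/
def initProb {B D : ℕ} (z₀ : BeliefState B D) (s : State B D) : ℝ :=
  if s.2 = z₀.2 then z₀.1 s.1 else 0

/-- The probability of a trajectory under a policy from the initial belief-state `z₀`. -/
def trajProb {B D : ℕ} (p lam : ℝ) (z₀ : BeliefState B D) (g : Policy B D) :
    ∀ t : ℕ, Traj B D t → ℝ
  | 0, s => initProb z₀ (s 0)
  | t + 1, s =>
      trajProb p lam z₀ g t (Fin.init s) *
        transProb p lam (Fin.init s (Fin.last t)) (g t (observe (Fin.init s))) (s (Fin.last (t + 1)))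

/-- The expected on-demand AoI in the `(t+1)`-st slot. -/
def expectedCost {B D : ℕ} (p lam : ℝ) (z₀ : BeliefState B D) (g : Policy B D) (t : ℕ) : ℝ :=
  ∑ s : Traj B D t, trajProb p lam z₀ g t s * cost (s (Fin.last t)) (g t (observe s))

/-- The average over the first `T` slots of the expected on-demand AoI. -/
def averageCost {B D : ℕ} (p lam : ℝ) (z₀ : BeliefState B D) (g : Policy B D) (T : ℕ) : ℝ :=
  (1 / (T : ℝ)) * ∑ t ∈ Finset.range T, expectedCost p lam z₀ g t

/-! ### Beliefs and policies that act on belief-states -/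

/-- The conditional law of the current battery level given the observed history `o`, when `μ` gives
the probabilities of the trajectories (histories of probability `0` get the value `0`). -/
def posterior {B D t : ℕ} (μ : Traj B D t → ℝ) (o : Fin (t + 1) → Obs B D) : Belief B :=
  fun j => (∑ s : Traj B D t, if observe s = o ∧ (s (Fin.last t)).1 = j then μ s else 0) /
    ∑ s : Traj B D t, if observe s = o then μ s else 0

/-- The probability of a trajectory when in every slot the action is `π z`, where `z` is the current
belief-state: the conditional law of the battery level given the history, and the current
observation. -/
def beliefTrajProb {B D : ℕ} (p lam : ℝ) (z₀ : BeliefState B D) (π : BeliefState B D → Action) :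
    ∀ t : ℕ, Traj B D t → ℝ
  | 0, s => initProb z₀ (s 0)
  | t + 1, s =>
      beliefTrajProb p lam z₀ π t (Fin.init s) *
        transProb p lam (Fin.init s (Fin.last t))
          (π (posterior (beliefTrajProb p lam z₀ π t) (observe (Fin.init s)),
            observe (Fin.init s) (Fin.last t)))
          (s (Fin.last (t + 1)))

/-- A policy `π : Z → A` on belief-states, run from `z₀`, as a history-dependent policy. -/
def beliefPolicy {B D : ℕ} (p lam : ℝ) (z₀ : BeliefState B D) (π : BeliefState B D → Action) :
    Policy B D :=
  fun t o => π (posterior (beliefTrajProb p lam z₀ π t) o, o (Fin.last t))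

/-- `beliefTrajProb` is the law of the trajectories under `beliefPolicy`, so the beliefs used by
`beliefPolicy` are the conditional laws of the battery level under that very policy. -/
theorem trajProb_beliefPolicy {B D : ℕ} (p lam : ℝ) (z₀ : BeliefState B D)
    (π : BeliefState B D → Action) (t : ℕ) :
    trajProb p lam z₀ (beliefPolicy p lam z₀ π) t = beliefTrajProb p lam z₀ π t := by
  induction t with
  | zero => rfl
  | succ t ih =>
    funext s
    simp only [trajProb, beliefTrajProb, ih]
    rfl

/-- The policy `π` on belief-states, run from `z₀`, has the long-run average cost `C`, as a limit,
and no history-dependent policy does better from `z₀`, not even along a subsequence. -/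
def IsOptimalFrom {B D : ℕ} (p lam : ℝ) (z₀ : BeliefState B D) (π : BeliefState B D → Action)
    (C : ℝ) : Prop :=
  Tendsto (averageCost p lam z₀ (beliefPolicy p lam z₀ π)) atTop (𝓝 C) ∧
    ∀ g : Policy B D, C ≤ liminf (averageCost p lam z₀ g) atTop

/-! ### The belief-state MDP -/

/-- `Pr(o' | z, a)`. -/
def obsProb {B D : ℕ} (p lam : ℝ) (z : BeliefState B D) (a : Action) (o' : Obs B D) : ℝ :=
  ∑ b : Fin (B + 1), z.1 b * ∑ b' : Fin (B + 1), transProb p lam (b, z.2) a (b', o')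

/-- Bayes' update of the belief after action `a` and next observation `o'`. -/
def bayesUpdate {B D : ℕ} (p lam : ℝ) (z : BeliefState B D) (a : Action) (o' : Obs B D) :
    Belief B :=
  fun j => (∑ b : Fin (B + 1), z.1 b * transProb p lam (b, z.2) a (j, o')) / obsProb p lam z a o'

/-- `c(z, a) + ∑_{o'} Pr(o' | z, a) h(z')`, where `z'` is the next belief-state. -/
def actionValue {B D : ℕ} (p lam : ℝ) (h : BeliefState B D → ℝ) (z : BeliefState B D)
    (a : Action) : ℝ :=
  (∑ b : Fin (B + 1), z.1 b * cost (b, z.2) a) +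
    ∑ o' : Obs B D, obsProb p lam z a o' * h (bayesUpdate p lam z a o', o')

/-- The banded matrix `Λ`: `1 - lam` on the diagonal except for a last entry `1`, and `lam` just
below the diagonal. -/
def Lam (B : ℕ) (lam : ℝ) : Matrix (Fin (B + 1)) (Fin (B + 1)) ℝ :=
  Matrix.of fun i j =>
    if i = j then (if j.1 = B then 1 else 1 - lam) else if i.1 = j.1 + 1 then lam else 0

/-- The vectors `ρ^j`: for `j ≥ 1` the entries `1 - lam` and `lam` stand at the positions `j - 1`
and `j`, and `ρ^0 = ρ^1`. -/
def rho (B : ℕ) (lam : ℝ) (j : ℕ) : Belief B :=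
  fun i => if i.1 + 1 = max j 1 then 1 - lam else if i.1 = max j 1 then lam else 0

/-- The explicit function `Q(z, a)` determined by a relative value function `h`. -/
def Q {B D : ℕ} (p lam : ℝ) (h : BeliefState B D → ℝ) : BeliefState B D → Action → ℝ
  | (β, r, x, k), a =>
    if a = 0 then
      ((r : ℕ) : ℝ) * min ((x.1 : ℝ) + 1) (D : ℝ) +
        ∑ r' : Fin 2, (((r' : ℕ) : ℝ) * p + (1 - ((r' : ℕ) : ℝ)) * (1 - p)) *
          h ((Lam B lam).mulVec β, r', ageStep x, k)
    else
      (((r : ℕ) : ℝ) * β 0 * min ((x.1 : ℝ) + 1) (D : ℝ) + ((r : ℕ) : ℝ) * (1 - β 0)) +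
        β 0 * ∑ r' : Fin 2, (((r' : ℕ) : ℝ) * p + (1 - ((r' : ℕ) : ℝ)) * (1 - p)) *
          h (rho B lam 0, r', ageStep x, k) +
        ∑ j : Set.Icc 1 B, β (level j) *
          (p * h (rho B lam j.1, 1, ageOne x, j) + (1 - p) * h (rho B lam j.1, 0, ageOne x, j))

/-- A belief space: a set of probability vectors on `{0,…,B}` that contains every `ρ^j` and is
closed under `Λ`. Examples are the set of all probability vectors and, for an initial belief `β`,
the countable set of all `Λ^m β` and `Λ^m ρ^j`. -/
def IsBeliefSpace {B : ℕ} (lam : ℝ) (S : Set (Belief B)) : Prop :=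
  S ⊆ stdSimplex ℝ (Fin (B + 1)) ∧ (∀ j ≤ B, rho B lam j ∈ S) ∧
    ∀ β ∈ S, (Lam B lam).mulVec β ∈ S

/-- `h` is bounded on the belief-states with belief in `S`. -/
def BoundedOn {B D : ℕ} (S : Set (Belief B)) (h : BeliefState B D → ℝ) : Prop :=
  ∃ K : ℝ, ∀ z : BeliefState B D, z.1 ∈ S → |h z| ≤ K

/-- The Bellman equation `C + h(z) = min_a Q(z, a)` on the belief-states with belief in `S`. -/
def SolvesBellman {B D : ℕ} (p lam : ℝ) (S : Set (Belief B)) (C : ℝ)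
    (h : BeliefState B D → ℝ) : Prop :=
  ∀ z : BeliefState B D, z.1 ∈ S → C + h z = min (Q p lam h z 0) (Q p lam h z 1)

end

end AoI

open Filter Topology

namespace AoI

/-! The proof has three ingredients: existence of a bounded solution, uniqueness of the constant,
and verification.

Existence. Requests are independent of everything else, and in `Q` the last reported level affects
neither costs nor beliefs. Averaging over the request therefore reduces the Bellman equation to `T u
= C + u` on pairs (belief, age). The operator `T` is monotone, commutes with adding constants and,
having finitely many successors, is continuous under pointwise convergence. For such an operator a
uniform bound on the oscillation of the value iterates suffices (`exists_average_solution`); neither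
compactness nor continuity in the belief is used. To bound the oscillation, `value_anti` shows that
the finite-horizon value decreases in the stochastic order of beliefs and increases with age, so
only the extreme states matter. If `lam > 0`, both extremes stay near the value just after an update
from a full battery: from an empty battery, `B` waits and one attempt reach that state with
probability at least `lam ^ B` (`value_zero_le`), while a full battery can only postpone reaching it
(`value_last_ge`). If `lam = 0`, only finitely many updates are ever possible and each saves a
bounded cost (`value_point_ge`), so the value is `n * (p * D)` up to a constant.

Uniqueness. `Q` is monotone and commutes with constants, so comparing two bounded solutions at the
supremum of their difference gives equal constants (`SolvesBellman.const_unique`). The solution on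
the whole simplex restricts to every belief space, which makes one constant serve them all.

Verification. For `D ≥ 2` the next age equals one exactly when an update arrived, so the Bayes
posterior is always `Λβ` or some `ρ^j`, and `Q` is the true action-value (`actionValue_eq_Q`).
Expected cost plus the change in expected `h` is then at least `C` in each slot, with equality for a
minimizing policy; bounded telescoping gives the averages. For `D = 1` success need not be visible
and this identity may fail, but the cost is simply `r`, so every policy has average cost `p`. -/

/-! ### Average-cost equation for abstract monotone operators. -/

/-- A quasi-additive real sequence stays within a bounded distance of a linear one. -/
theorem exists_linear_of_quasiadditive (G : ℕ → ℝ) (K : ℝ) (hK : 0 ≤ K)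
    (hadd : ∀ m n, |G (m + n) - G m - G n| ≤ K) : ∃ C : ℝ, ∀ n : ℕ, |G n - n * C| ≤ K := by
  have hup : ∀ m n : ℕ, G ((m + 1) * n) + K ≤ ((m + 1 : ℕ) : ℝ) * (G n + K) := by
    intro m n
    induction m with
    | zero => simp
    | succ m ih =>
      have h := (abs_le.1 (hadd ((m + 1) * n) n)).2
      have e : (m + 1 + 1) * n = (m + 1) * n + n := by ring
      rw [e]; push_cast at ih ⊢; linarith
  have hlo : ∀ m n : ℕ, ((m + 1 : ℕ) : ℝ) * (G n - K) ≤ G ((m + 1) * n) - K := by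
    intro m n
    induction m with
    | zero => simp
    | succ m ih =>
      have h := (abs_le.1 (hadd ((m + 1) * n) n)).1
      have e : (m + 1 + 1) * n = (m + 1) * n + n := by ring
      rw [e]; push_cast at ih ⊢; linarith
  -- `G + K` is subadditive and `G - K` superadditive; comparing both at `(m + 1) * (n + 1)` puts
  -- every lower quotient below every upper one. The slope `C` is any number in between.
  have hcross : ∀ m n : ℕ, (G (m + 1) - K) / ((m + 1 : ℕ) : ℝ) ≤
      (G (n + 1) + K) / ((n + 1 : ℕ) : ℝ) := by
    intro m n
    rw [div_le_div_iff₀ (by positivity) (by positivity)]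
    have h1 := hup m (n + 1)
    have h2 := hlo n (m + 1)
    rw [mul_comm (n + 1) (m + 1)] at h2
    linarith
  refine ⟨⨆ m : ℕ, (G (m + 1) - K) / ((m + 1 : ℕ) : ℝ), fun n => ?_⟩
  cases n with
  | zero => simpa using hadd 0 0
  | succ n =>
    have hn : (0 : ℝ) < ((n + 1 : ℕ) : ℝ) := by positivity
    have h1 : (G (n + 1) - K) / ((n + 1 : ℕ) : ℝ) ≤
        ⨆ m : ℕ, (G (m + 1) - K) / ((m + 1 : ℕ) : ℝ) :=
      le_ciSup (f := fun m : ℕ => (G (m + 1) - K) / ((m + 1 : ℕ) : ℝ))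
        ⟨_, by rintro _ ⟨m, rfl⟩; exact hcross m 0⟩ n
    have h2 : (⨆ m : ℕ, (G (m + 1) - K) / ((m + 1 : ℕ) : ℝ)) ≤
        (G (n + 1) + K) / ((n + 1 : ℕ) : ℝ) := ciSup_le fun m => hcross m n
    rw [div_le_iff₀ hn] at h1
    rw [le_div_iff₀ hn] at h2
    rw [abs_le]
    constructor <;> linarith

/-- A monotone operator that commutes with the addition of constants preserves bounds on
differences under iteration. -/
theorem iterate_le_add_const {Z : Type*} {T : (Z → ℝ) → Z → ℝ} (hmono : Monotone T)
    (hconst : ∀ (f : Z → ℝ) (c : ℝ), T (fun z => f z + c) = fun z => T f z + c)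
    {f g : Z → ℝ} {c : ℝ} (h : ∀ z, f z ≤ g z + c) (n : ℕ) (z : Z) :
    T^[n] f z ≤ T^[n] g z + c := by
  induction n generalizing z with
  | zero => exact h z
  | succ n ih =>
    rw [Function.iterate_succ_apply', Function.iterate_succ_apply']
    have := hmono (show T^[n] f ≤ fun z => T^[n] g z + c from ih) z
    rwa [hconst] at this

/-- If the value iterates `T^[n] 0` have uniformly bounded oscillation, then the average-cost
optimality equation `T h = C + h` has a bounded solution. -/
theorem exists_average_solution {Z : Type*} [Nonempty Z] (T : (Z → ℝ) → Z → ℝ)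
    (hmono : Monotone T)
    (hconst : ∀ (f : Z → ℝ) (c : ℝ), T (fun z => f z + c) = fun z => T f z + c)
    (hcont : ∀ (f : ℕ → Z → ℝ) (g : Z → ℝ), (∀ z, Tendsto (fun n => f n z) atTop (𝓝 (g z))) →
      ∀ z, Tendsto (fun n => T (f n) z) atTop (𝓝 (T g z)))
    (G : ℕ → ℝ) (K : ℝ) (hK : ∀ n z, |T^[n] (fun _ => 0) z - G n| ≤ K) :
    ∃ (C : ℝ) (h : Z → ℝ), (∃ M : ℝ, ∀ z, |h z| ≤ M) ∧ ∀ z, T h z = C + h z := by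
  obtain ⟨z₀⟩ := ‹Nonempty Z›
  have hK0 : 0 ≤ K := (abs_nonneg _).trans (hK 0 z₀)
  set v : ℕ → Z → ℝ := fun n => T^[n] (fun _ => 0) with hv
  -- The function `v m` is within `K` of the constant `G m`, so `n` further applications of `T` give
  -- `v n + G m` up to `K`; passing from `v` to `G` at `m + n` and at `n` costs `K` twice more.
  have hquasi : ∀ m n, |G (m + n) - G m - G n| ≤ 3 * K := by
    intro m n
    have e : v (m + n) = T^[n] (v m) := by
      simp only [hv]; rw [add_comm, Function.iterate_add_apply]
    have h1 := iterate_le_add_const hmono hconst (f := v m) (g := fun _ => 0) (c := G m + K)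
      (fun z => by have := (abs_le.1 (hK m z)).2; simp only [hv]; linarith) n z₀
    have h2 := iterate_le_add_const hmono hconst (f := fun _ => 0) (g := v m) (c := K - G m)
      (fun z => by have := (abs_le.1 (hK m z)).1; simp only [hv]; linarith) n z₀
    rw [← e] at h1 h2
    have h3 := abs_le.1 (hK (m + n) z₀)
    have h4 := abs_le.1 (hK n z₀)
    simp only [hv] at h1 h2
    rw [abs_le]
    constructor <;> linarith [h3.1, h3.2, h4.1, h4.2]
  obtain ⟨C, hC⟩ := exists_linear_of_quasiadditive G (3 * K) (by linarith) hquasi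
  set S : (Z → ℝ) → Z → ℝ := fun f z => T f z + -C with hS
  have hSmono : Monotone S := fun f g hfg z => by
    have := hmono hfg z
    simp only [hS]; linarith
  have hSconst : ∀ (f : Z → ℝ) (c : ℝ), S (fun z => f z + c) = fun z => S f z + c := by
    intro f c; funext z; simp only [hS]; rw [hconst]; ring
  set w : ℕ → Z → ℝ := fun n => S^[n] (fun _ => 0) with hw
  have hwv : ∀ n z, w n z = v n z + -(n * C) := by
    intro n
    induction n with
    | zero => intro z; simp [hw, hv]
    | succ n ih =>
      intro z
      have e1 : w (n + 1) = S (w n) := Function.iterate_succ_apply' _ _ _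
      have e2 : v (n + 1) = T (v n) := Function.iterate_succ_apply' _ _ _
      have e3 : w n = fun z => v n z + -(n * C) := funext ih
      rw [e1, e2, e3, hSconst]
      simp only [hS]; push_cast; ring
  -- `K` for the distance from `v n` to `G n`, and `3 * K` for that from `G n` to `n * C`.
  set L : ℝ := 4 * K with hL
  have hwL : ∀ n z, |w n z| ≤ L := by
    intro n z
    have h1 := abs_le.1 (hK n z)
    have h2 := abs_le.1 (hC n)
    rw [hwv, abs_le]
    simp only [hv]
    constructor <;> linarith [h1.1, h1.2, h2.1, h2.2]
  have hbdd : ∀ n z, BddBelow (Set.range fun k => w (n + k) z) := fun n z =>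
    ⟨-L, by rintro _ ⟨k, rfl⟩; exact (abs_le.1 (hwL _ z)).1⟩
  -- The iterates `w n` need not converge. Their pointwise liminf `b`, the increasing limit of these
  -- infima, satisfies `S b ≤ b` by monotonicity and continuity.
  set a : ℕ → Z → ℝ := fun n z => ⨅ k, w (n + k) z with ha
  have ha_lo : ∀ n z, -L ≤ a n z := fun n z => le_ciInf fun k => (abs_le.1 (hwL _ z)).1
  have ha_le : ∀ n k z, a n z ≤ w (n + k) z := fun n k z => ciInf_le (hbdd n z) k
  have ha_hi : ∀ n z, a n z ≤ L := fun n z => (ha_le n 0 z).trans (abs_le.1 (hwL _ z)).2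
  have ha_mono : ∀ z, Monotone fun n => a n z := fun z => monotone_nat_of_le_succ fun n =>
    le_ciInf fun k => by
      have := ha_le n (k + 1) z
      rwa [show n + (k + 1) = n + 1 + k by ring] at this
  have hSa : ∀ n z, S (a n) z ≤ a (n + 1) z := fun n z => le_ciInf fun k => by
    have h1 := hSmono (show a n ≤ w (n + k) from fun z => ha_le n k z) z
    have e : S (w (n + k)) = w (n + 1 + k) := by
      rw [show n + 1 + k = n + k + 1 by ring]
      exact (Function.iterate_succ_apply' _ _ _).symm
    rwa [e] at h1
  have hbA : ∀ z, BddAbove (Set.range fun n => a n z) := fun z =>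
    ⟨L, by rintro _ ⟨n, rfl⟩; exact ha_hi n z⟩
  set b : Z → ℝ := fun z => ⨆ n, a n z with hb
  have hab : ∀ n z, a n z ≤ b z := fun n z => le_ciSup (hbA z) n
  have hSb : S b ≤ b := by
    intro z
    have h1 := hcont a b (fun z => tendsto_atTop_ciSup (ha_mono z) (hbA z)) z
    have h2 : T b z ≤ C + b z := le_of_tendsto' h1 fun n => by
      have h3 := hSa n z
      have h4 := hab (n + 1) z
      simp only [hS] at h3; linarith
    simp only [hS]; linarith
  -- Starting from `S b ≤ b` the iterates decrease; they stay bounded because `b` is within a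
  -- constant of the zero function. Their limit is a fixed point of `S`.
  set f : ℕ → Z → ℝ := fun n => S^[n] b with hf
  have hfsucc : ∀ n, f (n + 1) = S (f n) := fun n => Function.iterate_succ_apply' _ _ _
  have hfanti : ∀ n, f (n + 1) ≤ f n := by
    intro n
    induction n with
    | zero => exact hSb
    | succ n ih => rw [hfsucc (n + 1), hfsucc n]; exact hSmono (by rw [← hfsucc n]; exact ih)
  have hflo : ∀ n z, -(2 * L) ≤ f n z := by
    intro n z
    have h1 := iterate_le_add_const hSmono hSconst (f := fun _ => 0) (g := b) (c := L)
      (fun z => by have := (ha_lo 0 z).trans (hab 0 z); linarith) n z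
    have h2 := (abs_le.1 (hwL n z)).1
    simp only [hw] at h2
    simp only [hf]; linarith
  have hbf : ∀ z, BddBelow (Set.range fun n => f n z) := fun z =>
    ⟨-(2 * L), by rintro _ ⟨n, rfl⟩; exact hflo n z⟩
  have hlim : ∀ z, Tendsto (fun n => f n z) atTop (𝓝 (⨅ n, f n z)) := fun z =>
    tendsto_atTop_ciInf (antitone_nat_of_succ_le fun n => hfanti n z) (hbf z)
  refine ⟨C, fun z => ⨅ n, f n z, ⟨2 * L, fun z => abs_le.2 ⟨le_ciInf fun n => hflo n z, ?_⟩⟩,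
    fun z => ?_⟩
  · have h1 : (⨅ n, f n z) ≤ f 0 z := ciInf_le (hbf z) 0
    have h2 : b z ≤ L := ciSup_le fun n => ha_hi n z
    have h3 : f 0 z = b z := rfl
    linarith
  · have h1 := hcont f _ hlim z
    have h2 : Tendsto (fun n => C + f (n + 1) z) atTop (𝓝 (C + ⨅ n, f n z)) :=
      ((tendsto_add_atTop_iff_nat 1).2 (hlim z)).const_add C
    refine tendsto_nhds_unique h1 (h2.congr fun n => ?_)
    rw [hfsucc]; simp only [hS]; ring

/-! ### Battery dynamics and the stochastic order on beliefs. -/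

variable {B D : ℕ} {p lam : ℝ}

theorem sum_eq_zero_add_level (f : Fin (B + 1) → ℝ) :
    ∑ b, f b = f 0 + ∑ j : Set.Icc 1 B, f (level j) := by
  rw [Fin.sum_univ_succ]
  congr 1
  let e : Fin B ≃ Set.Icc 1 B :=
    { toFun := fun i => ⟨i.1 + 1, Nat.succ_le_succ (Nat.zero_le _), i.2⟩
      invFun := fun j => ⟨j.1 - 1, by have := j.2.1; have := j.2.2; omega⟩
      left_inv := fun i => by ext; simp
      right_inv := fun j => by have := j.2.1; ext; simp only []; omega }
  exact Fintype.sum_equiv e _ _ fun i => rfl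

theorem batteryProb_zero (b b' : Fin (B + 1)) : batteryProb lam b 0 b' = Lam B lam b' b := by
  have h1 := b.2
  have h2 := b'.2
  simp only [batteryProb, Lam, Matrix.of_apply, Fin.ext_iff, if_true]
  split_ifs <;> first | rfl | omega

theorem batteryProb_one (b b' : Fin (B + 1)) : batteryProb lam b 1 b' = rho B lam b.1 b' := by
  simp only [batteryProb, rho]
  rw [if_neg (by decide)]
  rcases Nat.eq_zero_or_pos b.1 with h | h
  · simp only [h, if_true]
    simp only [show max 0 1 = 1 from rfl]
    split_ifs <;> first | rfl | omega
  · rw [max_eq_left h]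
    split_ifs <;> first | rfl | omega

theorem Lam_nonneg (hlam : lam ∈ Set.Icc (0 : ℝ) 1) (i j : Fin (B + 1)) : 0 ≤ Lam B lam i j := by
  have h0 := hlam.1
  have h1 := hlam.2
  simp only [Lam, Matrix.of_apply]
  split_ifs <;> linarith

theorem rho_nonneg (hlam : lam ∈ Set.Icc (0 : ℝ) 1) (j : ℕ) (i : Fin (B + 1)) :
    0 ≤ rho B lam j i := by
  have h0 := hlam.1
  have h1 := hlam.2
  simp only [rho]
  split_ifs <;> linarith

/-- The battery level after an arrival. -/
def levelUp (j : Fin (B + 1)) : Fin (B + 1) := ⟨min (j.1 + 1) B, by omega⟩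

theorem levelUp_mono : Monotone (levelUp (B := B)) := fun i j hij => by
  have : i.1 ≤ j.1 := hij
  simp only [levelUp, Fin.mk_le_mk]; omega

/-- This is the adjoint action on test functions. For a full battery `levelUp j = j`, and the two
weights add up to the exceptional last entry `1`. -/
theorem sum_Lam_mul (j : Fin (B + 1)) (f : Fin (B + 1) → ℝ) :
    ∑ i, Lam B lam i j * f i = (1 - lam) * f j + lam * f (levelUp j) := by
  have h : ∀ i, Lam B lam i j * f i =
      (if i = j then (1 - lam) * f i else 0) + (if i = levelUp j then lam * f i else 0) := by
    intro i
    have h1 := i.2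
    have h2 := j.2
    simp only [Lam, Matrix.of_apply, levelUp, Fin.ext_iff]
    split_ifs <;> first | (exfalso; omega) | ring
  simp only [h, Finset.sum_add_distrib, Finset.sum_ite_eq', Finset.mem_univ, if_true]

theorem sum_rho_mul (hB : 1 ≤ B) (j : Fin (B + 1)) (f : Fin (B + 1) → ℝ) :
    ∑ i, rho B lam j.1 i * f i =
      (1 - lam) * f ⟨j.1 - 1, by omega⟩ + lam * f ⟨max j.1 1, by omega⟩ := by
  have h : ∀ i, rho B lam j.1 i * f i =
      (if i = ⟨j.1 - 1, by omega⟩ then (1 - lam) * f i else 0) +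
        (if i = ⟨max j.1 1, by omega⟩ then lam * f i else 0) := by
    intro i
    simp only [rho, Fin.ext_iff]
    split_ifs <;> first | (exfalso; omega) | ring
  simp only [h, Finset.sum_add_distrib, Finset.sum_ite_eq', Finset.mem_univ, if_true]

theorem sum_Lam (j : Fin (B + 1)) : ∑ i, Lam B lam i j = 1 := by
  have := sum_Lam_mul (lam := lam) j fun _ => 1
  simpa using this

theorem sum_rho (hB : 1 ≤ B) (j : Fin (B + 1)) : ∑ i, rho B lam j.1 i = 1 := by
  have := sum_rho_mul (lam := lam) hB j fun _ => 1
  simpa using this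

theorem sum_mulVec_mul (M : Matrix (Fin (B + 1)) (Fin (B + 1)) ℝ) (β f : Fin (B + 1) → ℝ) :
    ∑ i, M.mulVec β i * f i = ∑ j, β j * ∑ i, M i j * f i := by
  simp only [Matrix.mulVec, dotProduct, Finset.sum_mul, Finset.mul_sum]
  rw [Finset.sum_comm]
  exact Finset.sum_congr rfl fun j _ => Finset.sum_congr rfl fun i _ => by ring

theorem sum_Lam_mulVec (β : Belief B) : ∑ i, (Lam B lam).mulVec β i = ∑ i, β i := by
  have := sum_mulVec_mul (Lam B lam) β fun _ => 1
  simpa [sum_Lam] using this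

theorem Lam_mulVec_mem (hlam : lam ∈ Set.Icc (0 : ℝ) 1) {β : Belief B}
    (hβ : β ∈ stdSimplex ℝ (Fin (B + 1))) :
    (Lam B lam).mulVec β ∈ stdSimplex ℝ (Fin (B + 1)) :=
  ⟨fun i => show 0 ≤ ∑ j, Lam B lam i j * β j from
      Finset.sum_nonneg fun j _ => mul_nonneg (Lam_nonneg hlam i j) (hβ.1 j),
    (sum_Lam_mulVec β).trans hβ.2⟩

theorem rho_mem (hB : 1 ≤ B) (hlam : lam ∈ Set.Icc (0 : ℝ) 1) (j : Fin (B + 1)) :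
    rho B lam j.1 ∈ stdSimplex ℝ (Fin (B + 1)) :=
  ⟨rho_nonneg hlam j.1, sum_rho hB j⟩

/-- `β` is stochastically smaller than `γ`. -/
def StochLE (β γ : Belief B) : Prop :=
  ∀ f : Fin (B + 1) → ℝ, Antitone f → ∑ i, γ i * f i ≤ ∑ i, β i * f i

/-- By duality it is enough that averaging over an arrival keeps a test function antitone, which
follows from monotonicity of `levelUp`. -/
theorem StochLE.mulVec (hlam : lam ∈ Set.Icc (0 : ℝ) 1) {β γ : Belief B} (h : StochLE β γ) :
    StochLE ((Lam B lam).mulVec β) ((Lam B lam).mulVec γ) := by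
  intro f hf
  rw [sum_mulVec_mul, sum_mulVec_mul]
  apply h
  intro i j hij
  simp only [sum_Lam_mul]
  have h0 := hlam.1
  have h1 : 0 ≤ 1 - lam := sub_nonneg.2 hlam.2
  have h2 := hf hij
  have h3 := hf (levelUp_mono hij)
  gcongr

theorem stochLE_rho (hB : 1 ≤ B) (hlam : lam ∈ Set.Icc (0 : ℝ) 1) {i j : Fin (B + 1)}
    (hij : i ≤ j) : StochLE (rho B lam i.1) (rho B lam j.1) := by
  intro f hf
  rw [sum_rho_mul hB, sum_rho_mul hB]
  have h0 := hlam.1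
  have h1 : 0 ≤ 1 - lam := sub_nonneg.2 hlam.2
  have h' : i.1 ≤ j.1 := hij
  gcongr
  · exact hf (Fin.mk_le_mk.2 (by omega))
  · exact hf (Fin.mk_le_mk.2 (by omega))

theorem StochLE.refl (β : Belief B) : StochLE β β := fun _ _ => le_rfl

theorem stochLE_single_last {β : Belief B} (hβ : β ∈ stdSimplex ℝ (Fin (B + 1))) :
    StochLE β (Pi.single (Fin.last B) 1) := by
  intro f hf
  have e : ∑ i, (Pi.single (Fin.last B) 1 : Belief B) i * f i = f (Fin.last B) := by
    simp [Pi.single_apply]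
  rw [e]
  calc f (Fin.last B) = ∑ i, β i * f (Fin.last B) := by rw [← Finset.sum_mul, hβ.2, one_mul]
    _ ≤ _ := Finset.sum_le_sum fun i _ => mul_le_mul_of_nonneg_left (hf (Fin.le_last i)) (hβ.1 i)

theorem single_zero_stochLE {β : Belief B} (hβ : β ∈ stdSimplex ℝ (Fin (B + 1))) :
    StochLE (Pi.single 0 1) β := by
  intro f hf
  have e : ∑ i, (Pi.single 0 1 : Belief B) i * f i = f 0 := by
    simp [Pi.single_apply]
  rw [e]
  calc ∑ i, β i * f i ≤ ∑ i, β i * f 0 :=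
        Finset.sum_le_sum fun i _ => mul_le_mul_of_nonneg_left (hf (Fin.zero_le i)) (hβ.1 i)
    _ = _ := by rw [← Finset.sum_mul, hβ.2, one_mul]

theorem single_mem (j : Fin (B + 1)) :
    (Pi.single j 1 : Belief B) ∈ stdSimplex ℝ (Fin (B + 1)) := single_mem_stdSimplex ℝ j

noncomputable section

/-! ### The reduced problem

Averaging over the request indicator and dropping the last reported level, which influences
neither costs nor beliefs, leaves a problem on pairs (belief, age). -/

/-- The belief after a slot without update. -/
def waitBelief (hlam : lam ∈ Set.Icc (0 : ℝ) 1) (β : stdSimplex ℝ (Fin (B + 1))) :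
    stdSimplex ℝ (Fin (B + 1)) := ⟨(Lam B lam).mulVec β.1, Lam_mulVec_mem hlam β.2⟩

/-- The belief after an attempted update at level `j`. -/
def sentBelief (hB : 1 ≤ B) (hlam : lam ∈ Set.Icc (0 : ℝ) 1) (j : Fin (B + 1)) :
    stdSimplex ℝ (Fin (B + 1)) := ⟨rho B lam j.1, rho_mem hB hlam j⟩

/-- The belief that is certain of the level `j`. -/
def pointBelief (j : Fin (B + 1)) : stdSimplex ℝ (Fin (B + 1)) := ⟨Pi.single j 1, single_mem j⟩

/-- The value of waiting in the reduced problem. -/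
def waitValue (hlam : lam ∈ Set.Icc (0 : ℝ) 1)
    (u : stdSimplex ℝ (Fin (B + 1)) × Set.Icc 1 D → ℝ) (r : ℝ)
    (y : stdSimplex ℝ (Fin (B + 1)) × Set.Icc 1 D) : ℝ :=
  r * ((ageStep y.2).1 : ℝ) + u (waitBelief hlam y.1, ageStep y.2)

/-- The value of an attempted update when the battery level is `b`. -/
def sendOutcome (hB : 1 ≤ B) (hlam : lam ∈ Set.Icc (0 : ℝ) 1)
    (u : stdSimplex ℝ (Fin (B + 1)) × Set.Icc 1 D → ℝ) (r : ℝ) (x : Set.Icc 1 D)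
    (b : Fin (B + 1)) : ℝ :=
  if b = 0 then r * ((ageStep x).1 : ℝ) + u (sentBelief hB hlam 0, ageStep x)
  else r + u (sentBelief hB hlam b, ageOne x)

/-- The value of an attempted update in the reduced problem. -/
def sendValue (hB : 1 ≤ B) (hlam : lam ∈ Set.Icc (0 : ℝ) 1)
    (u : stdSimplex ℝ (Fin (B + 1)) × Set.Icc 1 D → ℝ) (r : ℝ)
    (y : stdSimplex ℝ (Fin (B + 1)) × Set.Icc 1 D) : ℝ :=
  ∑ b, y.1.1 b * sendOutcome hB hlam u r y.2 b

/-- The Bellman operator of the reduced problem. -/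
def bellman (p : ℝ) (hB : 1 ≤ B) (hlam : lam ∈ Set.Icc (0 : ℝ) 1)
    (u : stdSimplex ℝ (Fin (B + 1)) × Set.Icc 1 D → ℝ)
    (y : stdSimplex ℝ (Fin (B + 1)) × Set.Icc 1 D) : ℝ :=
  p * min (waitValue hlam u 1 y) (sendValue hB hlam u 1 y) +
    (1 - p) * min (waitValue hlam u 0 y) (sendValue hB hlam u 0 y)

/-- The optimal cost over `n` slots in the reduced problem. -/
def value (p : ℝ) (hB : 1 ≤ B) (hlam : lam ∈ Set.Icc (0 : ℝ) 1) (n : ℕ) :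
    stdSimplex ℝ (Fin (B + 1)) × Set.Icc 1 D → ℝ :=
  (bellman p hB hlam)^[n] fun _ => 0

variable (hB : 1 ≤ B) (hlam : lam ∈ Set.Icc (0 : ℝ) 1) (hp : p ∈ Set.Icc (0 : ℝ) 1)

/-! ### The reduced Bellman operator and monotonicity of its values. -/

theorem value_succ (n : ℕ) :
    value (D := D) p hB hlam (n + 1) = bellman p hB hlam (value p hB hlam n) :=
  Function.iterate_succ_apply' _ _ _

theorem ageStep_le (x : Set.Icc 1 D) : ((ageStep x).1 : ℝ) ≤ D := by
  exact_mod_cast (ageStep x).2.2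

theorem one_le_ageStep (x : Set.Icc 1 D) : (1 : ℝ) ≤ ((ageStep x).1 : ℝ) := by
  exact_mod_cast (ageStep x).2.1

theorem one_le_D (x : Set.Icc 1 D) : (1 : ℝ) ≤ D := by
  exact_mod_cast x.2.1.trans x.2.2

theorem ageStep_mono : Monotone (ageStep (D := D)) := fun x y hxy => by
  have h : x.1 ≤ y.1 := hxy
  change min (x.1 + 1) D ≤ min (y.1 + 1) D
  omega

theorem ageOne_le (x y : Set.Icc 1 D) : ageOne x ≤ y := y.2.1

theorem sendValue_eq_add_const (u : stdSimplex ℝ (Fin (B + 1)) × Set.Icc 1 D → ℝ) (c r : ℝ)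
    (y : stdSimplex ℝ (Fin (B + 1)) × Set.Icc 1 D) :
    sendValue hB hlam (fun z => u z + c) r y = sendValue hB hlam u r y + c := by
  have h : ∀ b, sendOutcome hB hlam (fun z => u z + c) r y.2 b =
      sendOutcome hB hlam u r y.2 b + c := by
    intro b; simp only [sendOutcome]; split_ifs <;> ring
  simp only [sendValue, h, mul_add, Finset.sum_add_distrib, ← Finset.sum_mul, y.1.2.2, one_mul]

theorem sendOutcome_mono {u u' : stdSimplex ℝ (Fin (B + 1)) × Set.Icc 1 D → ℝ} (h : u ≤ u')
    (r : ℝ) (x : Set.Icc 1 D) (b : Fin (B + 1)) :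
    sendOutcome hB hlam u r x b ≤ sendOutcome hB hlam u' r x b := by
  simp only [sendOutcome]
  split_ifs
  · exact add_le_add_right (h _) _
  · exact add_le_add_right (h _) _

include hp in
theorem bellman_mono : Monotone (bellman (D := D) p hB hlam) := by
  intro u u' h y
  have hw : ∀ r, waitValue hlam u r y ≤ waitValue hlam u' r y := fun r =>
    add_le_add_right (h _) _
  have hs : ∀ r, sendValue hB hlam u r y ≤ sendValue hB hlam u' r y := fun r =>
    Finset.sum_le_sum fun b _ =>
      mul_le_mul_of_nonneg_left (sendOutcome_mono hB hlam h r y.2 b) (y.1.2.1 b)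
  exact add_le_add (mul_le_mul_of_nonneg_left (min_le_min (hw 1) (hs 1)) hp.1)
    (mul_le_mul_of_nonneg_left (min_le_min (hw 0) (hs 0)) (sub_nonneg.2 hp.2))

theorem bellman_add_const (u : stdSimplex ℝ (Fin (B + 1)) × Set.Icc 1 D → ℝ) (c : ℝ) :
    bellman p hB hlam (fun z => u z + c) = fun z => bellman p hB hlam u z + c := by
  funext y
  have hw : ∀ r, waitValue hlam (fun z => u z + c) r y = waitValue hlam u r y + c := fun r => by
    simp only [waitValue]; ring
  simp only [bellman, hw, sendValue_eq_add_const, min_add_add_right]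
  ring

/-- For each belief and age, only finitely many values of `u` enter, through sums and minima. -/
theorem bellman_tendsto (f : ℕ → stdSimplex ℝ (Fin (B + 1)) × Set.Icc 1 D → ℝ)
    (g : stdSimplex ℝ (Fin (B + 1)) × Set.Icc 1 D → ℝ)
    (h : ∀ z, Tendsto (fun n => f n z) atTop (𝓝 (g z)))
    (y : stdSimplex ℝ (Fin (B + 1)) × Set.Icc 1 D) :
    Tendsto (fun n => bellman p hB hlam (f n) y) atTop (𝓝 (bellman p hB hlam g y)) := by
  have hw : ∀ r, Tendsto (fun n => waitValue hlam (f n) r y) atTop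
      (𝓝 (waitValue hlam g r y)) := fun r => (h _).const_add _
  have hs : ∀ r, Tendsto (fun n => sendValue hB hlam (f n) r y) atTop
      (𝓝 (sendValue hB hlam g r y)) := fun r => by
    refine tendsto_finsetSum _ fun b _ => Tendsto.const_mul _ ?_
    simp only [sendOutcome]
    split_ifs
    · exact (h _).const_add _
    · exact (h _).const_add _
  exact (((hw 1).min (hs 1)).const_mul p).add (((hw 0).min (hs 0)).const_mul (1 - p))

include hp in
-- A lower bound affine in the request `r` survives averaging over it: the slope `d` contributes `p
-- * d`. This keeps the request probability in lower bounds when the age is at its cap.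
theorem le_bellman {u : stdSimplex ℝ (Fin (B + 1)) × Set.Icc 1 D → ℝ}
    {y : stdSimplex ℝ (Fin (B + 1)) × Set.Icc 1 D} {c d : ℝ}
    (hw : ∀ r ∈ Set.Icc (0 : ℝ) 1, c + r * d ≤ waitValue hlam u r y)
    (hs : ∀ r ∈ Set.Icc (0 : ℝ) 1, c + r * d ≤ sendValue hB hlam u r y) :
    c + p * d ≤ bellman p hB hlam u y := by
  have h1 := le_min (hw 1 (by simp)) (hs 1 (by simp))
  have h0 := le_min (hw 0 (by simp)) (hs 0 (by simp))
  calc c + p * d = p * (c + 1 * d) + (1 - p) * (c + 0 * d) := by ring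
    _ ≤ _ := add_le_add (mul_le_mul_of_nonneg_left h1 hp.1)
      (mul_le_mul_of_nonneg_left h0 (sub_nonneg.2 hp.2))

include hp in
theorem bellman_le_wait (u : stdSimplex ℝ (Fin (B + 1)) × Set.Icc 1 D → ℝ)
    (y : stdSimplex ℝ (Fin (B + 1)) × Set.Icc 1 D) :
    bellman p hB hlam u y ≤ p * D + u (waitBelief hlam y.1, ageStep y.2) := by
  have h1 := min_le_left (waitValue hlam u 1 y) (sendValue hB hlam u 1 y)
  have h0 := min_le_left (waitValue hlam u 0 y) (sendValue hB hlam u 0 y)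
  calc bellman p hB hlam u y ≤ p * waitValue hlam u 1 y + (1 - p) * waitValue hlam u 0 y :=
        add_le_add (mul_le_mul_of_nonneg_left h1 hp.1)
          (mul_le_mul_of_nonneg_left h0 (sub_nonneg.2 hp.2))
    _ = p * ((ageStep y.2).1 : ℝ) + u (waitBelief hlam y.1, ageStep y.2) := by
        simp only [waitValue]; ring
    _ ≤ _ := add_le_add_left (mul_le_mul_of_nonneg_left (ageStep_le _) hp.1) _

include hp in
theorem bellman_le_send {u : stdSimplex ℝ (Fin (B + 1)) × Set.Icc 1 D → ℝ}
    {y : stdSimplex ℝ (Fin (B + 1)) × Set.Icc 1 D} {c : ℝ}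
    (h : ∀ r ∈ Set.Icc (0 : ℝ) 1, sendValue hB hlam u r y ≤ c) :
    bellman p hB hlam u y ≤ c := by
  have h1 := (min_le_right (waitValue hlam u 1 y) _).trans (h 1 (by simp))
  have h0 := (min_le_right (waitValue hlam u 0 y) _).trans (h 0 (by simp))
  calc bellman p hB hlam u y ≤ p * c + (1 - p) * c :=
        add_le_add (mul_le_mul_of_nonneg_left h1 hp.1)
          (mul_le_mul_of_nonneg_left h0 (sub_nonneg.2 hp.2))
    _ = c := by ring

include hp in
theorem value_le_succ (n : ℕ) : value (D := D) p hB hlam n ≤ value p hB hlam (n + 1) := by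
  induction n with
  | zero =>
    intro y
    rw [value_succ]
    have := le_bellman hB hlam hp (u := value p hB hlam 0) (y := y) (c := 0) (d := 0)
      (fun r hr => by
        simp only [waitValue, value, Function.iterate_zero, id, mul_zero, add_zero]
        exact mul_nonneg hr.1 (Nat.cast_nonneg _))
      (fun r hr => by
        simp only [mul_zero, add_zero]
        refine Finset.sum_nonneg fun b _ => mul_nonneg (y.1.2.1 b) ?_
        simp only [sendOutcome, value, Function.iterate_zero, id, add_zero]
        split_ifs
        · exact mul_nonneg hr.1 (Nat.cast_nonneg _)
        · exact hr.1)
    simpa [value] using this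
  | succ n ih =>
    rw [value_succ, value_succ hB hlam (n + 1)]
    exact bellman_mono hB hlam hp ih

include hp in
theorem value_monotone : Monotone (value (D := D) p hB hlam) :=
  monotone_nat_of_le_succ (value_le_succ hB hlam hp)

include hp in
-- Always waiting costs at most `p * D` in one slot; the extra slot is placed at the end of the
-- horizon, where it shifts the terminal value.
theorem value_succ_le (n : ℕ) (y : stdSimplex ℝ (Fin (B + 1)) × Set.Icc 1 D) :
    value p hB hlam (n + 1) y ≤ value p hB hlam n y + p * D := by
  have e : value (D := D) p hB hlam (n + 1) = (bellman p hB hlam)^[n] (value p hB hlam 1) := by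
    simp only [value]; rw [Function.iterate_add_apply]
  rw [e]
  refine iterate_le_add_const (bellman_mono hB hlam hp) (bellman_add_const hB hlam) (fun z => ?_) n y
  have := bellman_le_wait hB hlam hp (fun _ => 0) z
  simp only [value, Function.iterate_one]
  linarith

include hp in
/-- The optimal cost decreases with the battery level and increases with the age. -/
theorem value_anti (n : ℕ) {β γ : stdSimplex ℝ (Fin (B + 1))} (h : StochLE β.1 γ.1)
    {x y : Set.Icc 1 D} (hxy : x ≤ y) : value p hB hlam n (γ, x) ≤ value p hB hlam n (β, y) := by
  induction n generalizing β γ x y with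
  | zero => exact le_rfl
  | succ n ih =>
    rw [value_succ]
    set u : stdSimplex ℝ (Fin (B + 1)) × Set.Icc 1 D → ℝ := value p hB hlam n
    have hage : ((ageStep x).1 : ℝ) ≤ ((ageStep y).1 : ℝ) := by
      exact_mod_cast ageStep_mono hxy
    have hw : ∀ r ∈ Set.Icc (0 : ℝ) 1, waitValue hlam u r (γ, x) ≤ waitValue hlam u r (β, y) :=
      fun r hr => add_le_add (mul_le_mul_of_nonneg_left hage hr.1)
        (ih (StochLE.mulVec hlam h) (ageStep_mono hxy))
    have hs : ∀ r ∈ Set.Icc (0 : ℝ) 1,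
        sendValue hB hlam u r (γ, x) ≤ sendValue hB hlam u r (β, y) := by
      intro r hr
      -- A failed attempt is costlier than a successful one, both now and through the resulting age;
      -- among successes a higher level leaves a better belief.
      have hanti : Antitone (sendOutcome hB hlam u r x) := by
        intro i j hij
        by_cases hi : i = 0
        · by_cases hj : j = 0
          · rw [hi, hj]
          · simp only [sendOutcome, if_pos hi, if_neg hj]
            refine add_le_add (le_mul_of_one_le_right hr.1 (one_le_ageStep x)) ?_
            exact ih (stochLE_rho hB hlam (Fin.zero_le j)) (ageOne_le _ _)
        · have hj : j ≠ 0 := fun hj => hi (le_antisymm (hj ▸ hij) (Fin.zero_le i))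
          simp only [sendOutcome, if_neg hi, if_neg hj]
          exact add_le_add_right (ih (stochLE_rho hB hlam hij) le_rfl) _
      refine (h _ hanti).trans (Finset.sum_le_sum fun b _ =>
        mul_le_mul_of_nonneg_left ?_ (β.2.1 b))
      simp only [sendOutcome]
      split_ifs
      · exact add_le_add (mul_le_mul_of_nonneg_left hage hr.1)
          (ih (StochLE.refl _) (ageStep_mono hxy))
      · exact le_rfl
    exact add_le_add
      (mul_le_mul_of_nonneg_left (min_le_min (hw 1 (by simp)) (hs 1 (by simp))) hp.1)
      (mul_le_mul_of_nonneg_left (min_le_min (hw 0 (by simp)) (hs 0 (by simp)))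
        (sub_nonneg.2 hp.2))

theorem sendValue_pointBelief (u : stdSimplex ℝ (Fin (B + 1)) × Set.Icc 1 D → ℝ) (r : ℝ)
    (b : Fin (B + 1)) (x : Set.Icc 1 D) :
    sendValue hB hlam u r (pointBelief b, x) = sendOutcome hB hlam u r x b := by
  simp [sendValue, pointBelief, Pi.single_apply]

theorem waitBelief_last :
    waitBelief hlam (pointBelief (Fin.last B)) = pointBelief (Fin.last B) := by
  refine Subtype.ext (funext fun i => ?_)
  have h := i.2
  simp only [waitBelief, pointBelief, Matrix.mulVec_single_one, Matrix.col_apply, Lam,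
    Matrix.of_apply, Pi.single_apply, Fin.ext_iff, Fin.val_last, if_true]
  split_ifs <;> first | rfl | omega

/-! ### Oscillation bounds for the finite-horizon values. -/

include hp in
/-- A full battery is worth only boundedly more than the situation just after an update from a
full battery. -/
theorem value_last_ge (n : ℕ) (x : Set.Icc 1 D) :
    value p hB hlam n (sentBelief hB hlam (Fin.last B), ageOne x) - D * (1 + D - (x.1 : ℝ)) ≤
      value p hB hlam n (pointBelief (Fin.last B), x) := by
  have hlast : Fin.last B ≠ 0 := by
    intro h; have := congrArg Fin.val h; simp at this; omega
  induction n generalizing x with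
  | zero =>
    have h1 : (x.1 : ℝ) ≤ D := by exact_mod_cast x.2.2
    have h2 : (0 : ℝ) ≤ D * (1 + D - (x.1 : ℝ)) := mul_nonneg (Nat.cast_nonneg _) (by linarith)
    simpa [value] using h2
  | succ n ih =>
    set g : ℕ → ℝ := fun n => value p hB hlam n (sentBelief hB hlam (Fin.last B), ageOne x) with hg
    have hgs : g (n + 1) ≤ g n + p * D := value_succ_le hB hlam hp n _
    have hD0 : (0 : ℝ) ≤ D := Nat.cast_nonneg _
    have hpD : p * D ≤ D := mul_le_of_le_one_left hD0 hp.2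
    have hxD : (x.1 : ℝ) ≤ D := by exact_mod_cast x.2.2
    have ih' : g n - D * (1 + D - ((ageStep x).1 : ℝ)) ≤
      value p hB hlam n (pointBelief (Fin.last B), ageStep x) := ih (ageStep x)
    have hsend : ∀ r, sendValue hB hlam (value p hB hlam n) r (pointBelief (Fin.last B), x) =
        r + g n := fun r => by
      rw [sendValue_pointBelief, sendOutcome, if_neg hlast]
    change g (n + 1) - _ ≤ _
    rw [value_succ hB hlam n]
    have hDx : 0 ≤ (D : ℝ) * (D - x.1) := mul_nonneg hD0 (by linarith)
    rcases lt_or_eq_of_le x.2.2 with hx | hx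
    -- Below the cap, waiting raises the age and so releases `D` of the allowance `D * (1 + D - x)`,
    -- which covers the growth `g (n + 1) - g n ≤ p * D`.
    · have hst : ((ageStep x).1 : ℝ) = x.1 + 1 := by
        simp only [ageStep]; rw [min_eq_left (by omega)]; push_cast; rfl
      have := le_bellman hB hlam hp (u := value p hB hlam n)
        (y := (pointBelief (Fin.last B), x)) (c := g (n + 1) - D * (1 + D - (x.1 : ℝ))) (d := 0)
        (fun r hr => by
          simp only [waitValue, waitBelief_last]
          have : 0 ≤ r * ((ageStep x).1 : ℝ) := mul_nonneg hr.1 (Nat.cast_nonneg _)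
          rw [hst] at ih'
          nlinarith)
        (fun r hr => by
          rw [hsend]
          nlinarith [hr.1])
      simpa using this
    -- At the cap no allowance is released, but waiting itself costs `p * D` on average, which is at
    -- least the growth of `g`.
    · have hst : ((ageStep x).1 : ℝ) = D := by
        simp only [ageStep]; rw [min_eq_right (by omega)]
      have := le_bellman hB hlam hp (u := value p hB hlam n)
        (y := (pointBelief (Fin.last B), x)) (c := g n - D) (d := D)
        (fun r hr => by
          simp only [waitValue, waitBelief_last]
          rw [hst] at ih' ⊢
          linarith)
        (fun r hr => by
          rw [hsend]
          have : r * D ≤ D := mul_le_of_le_one_left hD0 hr.2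
          linarith [hr.1])
      have hx' : (x.1 : ℝ) = D := by exact_mod_cast hx
      rw [hx']
      linarith

/-- The largest age. -/
def ageTop (hD : 1 ≤ D) : Set.Icc 1 D := ⟨D, hD, le_rfl⟩

theorem ageStep_top (hD : 1 ≤ D) : ageStep (ageTop hD) = ageTop hD := by
  ext; simp only [ageStep, ageTop]; omega

theorem le_ageTop (hD : 1 ≤ D) (x : Set.Icc 1 D) : x ≤ ageTop hD := x.2.2

include hp in
theorem value_add_le_wait (hD : 1 ≤ D) (n k : ℕ) (β : stdSimplex ℝ (Fin (B + 1))) :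
    value p hB hlam (n + k) (β, ageTop hD) ≤
      k * D + value p hB hlam n ((waitBelief hlam)^[k] β, ageTop hD) := by
  have hpD : p * D ≤ D := mul_le_of_le_one_left (Nat.cast_nonneg _) hp.2
  induction k generalizing β with
  | zero => simp
  | succ k ih =>
    rw [← add_assoc, value_succ, Function.iterate_succ_apply]
    have h1 := bellman_le_wait hB hlam hp (value p hB hlam (n + k)) (β, ageTop hD)
    simp only [ageStep_top] at h1
    have h2 := ih (waitBelief hlam β)
    push_cast
    linarith

/-- Only the path with an arrival in every slot is counted. -/
theorem pow_le_iterate_waitBelief (m : ℕ) (hm : m < B + 1) :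
    lam ^ m ≤ ((waitBelief hlam)^[m] (pointBelief 0)).1 ⟨m, hm⟩ := by
  induction m with
  | zero => simp [pointBelief]
  | succ m ih =>
    rw [Function.iterate_succ_apply']
    set β := (waitBelief hlam)^[m] (pointBelief (B := B) 0)
    calc lam ^ (m + 1) = lam * lam ^ m := pow_succ' _ _
      _ ≤ lam * β.1 ⟨m, by omega⟩ := mul_le_mul_of_nonneg_left (ih (by omega)) hlam.1
      _ = Lam B lam ⟨m + 1, hm⟩ ⟨m, by omega⟩ * β.1 ⟨m, by omega⟩ := by simp [Lam]
      _ ≤ ∑ j, Lam B lam ⟨m + 1, hm⟩ j * β.1 j :=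
        Finset.single_le_sum (f := fun j => Lam B lam ⟨m + 1, hm⟩ j * β.1 j)
          (fun j _ => mul_nonneg (Lam_nonneg hlam _ j) (β.2.1 j)) (Finset.mem_univ _)

include hp in
-- Every outcome of an attempt is bounded by the worst continuation, except the one from a full
-- battery, which is credited with its gain `m - g`.
theorem value_send_le (hD : 1 ≤ D) (n : ℕ) (γ : stdSimplex ℝ (Fin (B + 1))) :
    value p hB hlam (n + 1) (γ, ageTop hD) ≤
      D + value p hB hlam n (pointBelief 0, ageTop hD) - γ.1 (Fin.last B) *
        (value p hB hlam n (pointBelief 0, ageTop hD) -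
          value p hB hlam n (sentBelief hB hlam (Fin.last B), ageOne (ageTop hD))) := by
  have hlast : Fin.last B ≠ 0 := by
    intro h; have := congrArg Fin.val h; simp at this; omega
  have hD1 : (1 : ℝ) ≤ D := one_le_D (ageTop hD)
  rw [value_succ]
  refine bellman_le_send hB hlam hp fun r hr => ?_
  set u : stdSimplex ℝ (Fin (B + 1)) × Set.Icc 1 D → ℝ := value p hB hlam n with hu
  set m := u (pointBelief 0, ageTop hD)
  set g := u (sentBelief hB hlam (Fin.last B), ageOne (ageTop hD))
  have hm : ∀ β x, u (β, x) ≤ m := fun β x =>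
    value_anti hB hlam hp n (single_zero_stochLE β.2) (le_ageTop hD x)
  have hout : ∀ b, sendOutcome hB hlam u r (ageTop hD) b ≤
      (D + m) - if b = Fin.last B then m - g else 0 := by
    intro b
    by_cases hb : b = Fin.last B
    · rw [if_pos hb, hb, sendOutcome, if_neg hlast]
      have : r ≤ 1 := hr.2
      simp only [g]; linarith
    · rw [if_neg hb, sendOutcome]
      split_ifs
      · have h1 : r * ((ageStep (ageTop hD)).1 : ℝ) ≤ D :=
          (mul_le_of_le_one_left (Nat.cast_nonneg _) hr.2).trans (ageStep_le _)
        linarith [hm (sentBelief hB hlam 0) (ageStep (ageTop hD))]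
      · linarith [hm (sentBelief hB hlam b) (ageOne (ageTop hD)), hr.2]
  calc sendValue hB hlam u r (γ, ageTop hD)
      ≤ ∑ b, γ.1 b * ((D + m) - if b = Fin.last B then m - g else 0) :=
        Finset.sum_le_sum fun b _ => mul_le_mul_of_nonneg_left (hout b) (γ.2.1 b)
    _ = D + m - γ.1 (Fin.last B) * (m - g) := by
        simp only [mul_sub, Finset.sum_sub_distrib, ← Finset.sum_mul, γ.2.2, mul_ite, mul_zero,
          Finset.sum_ite_eq', Finset.mem_univ, if_true, one_mul]

include hp in
/-- With energy arrivals, an empty battery costs only boundedly more than the situation just after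
an update from a full battery. -/
theorem value_zero_le (hD : 1 ≤ D) (hpos : 0 < lam) (n : ℕ) :
    value p hB hlam n (pointBelief 0, ageTop hD) -
      value p hB hlam n (sentBelief hB hlam (Fin.last B), ageOne (ageTop hD)) ≤
        (B + 1) * D / lam ^ B := by
  set m : ℕ → ℝ := fun n => value p hB hlam n (pointBelief 0, ageTop hD) with hm
  set g : ℕ → ℝ := fun n =>
    value p hB hlam n (sentBelief hB hlam (Fin.last B), ageOne (ageTop hD)) with hg
  have hε : 0 < lam ^ B := pow_pos hpos B
  have hε1 : lam ^ B ≤ 1 := pow_le_one₀ hlam.1 hlam.2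
  have hD0 : (0 : ℝ) ≤ D := Nat.cast_nonneg _
  change m n - g n ≤ _
  induction n using Nat.strong_induction_on with
  | _ n ih =>
    rcases lt_or_ge n (B + 1) with hn | hn
    · have h1 : m n ≤ n * D := by
        have := value_add_le_wait hB hlam hp hD 0 n (pointBelief 0)
        simpa [value, hm] using this
      have h2 : 0 ≤ g n := value_monotone hB hlam hp (Nat.zero_le n) _
      have h3 : (n : ℝ) ≤ B + 1 := by exact_mod_cast hn.le
      have h4 : (n : ℝ) * D ≤ (B + 1) * D := mul_le_mul_of_nonneg_right h3 hD0
      have h5 : (B + 1) * (D : ℝ) ≤ (B + 1) * D / lam ^ B :=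
        le_div_self (by positivity) hε hε1
      linarith
    -- A round of `B` waits and one attempt, with `g` nondecreasing in the horizon, bounds the gap
    -- at `k + (B + 1)` by `(B + 1) * D` plus `1 - lam ^ B` times the gap at `k`. The claimed bound
    -- is the fixed point of this recursion.
    · obtain ⟨k, rfl⟩ := Nat.exists_eq_add_of_le' hn
      have h1 : m (k + (B + 1)) ≤ B * D +
          value p hB hlam (k + 1) ((waitBelief hlam)^[B] (pointBelief 0), ageTop hD) := by
        have := value_add_le_wait hB hlam hp hD (k + 1) B (pointBelief 0)
        rwa [show k + 1 + B = k + (B + 1) by ring] at this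
      set γ := (waitBelief hlam)^[B] (pointBelief (B := B) 0)
      have h2 : value p hB hlam (k + 1) (γ, ageTop hD) ≤
        D + m k - γ.1 (Fin.last B) * (m k - g k) := value_send_le hB hlam hp hD k γ
      have h3 : lam ^ B ≤ γ.1 (Fin.last B) :=
        pow_le_iterate_waitBelief hlam B (Nat.lt_succ_self B)
      have h4 : g k ≤ m k :=
        value_anti hB hlam hp k (single_zero_stochLE (sentBelief hB hlam _).2) (le_ageTop hD _)
      have h5 : g k ≤ g (k + (B + 1)) := value_monotone hB hlam hp (Nat.le_add_right _ _) _
      have h6 := ih k (by omega)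
      have h7 : lam ^ B * (m k - g k) ≤ γ.1 (Fin.last B) * (m k - g k) :=
        mul_le_mul_of_nonneg_right h3 (by linarith)
      have h8 : (1 - lam ^ B) * (m k - g k) ≤ (1 - lam ^ B) * ((B + 1) * D / lam ^ B) :=
        mul_le_mul_of_nonneg_left h6 (by linarith)
      have h9 : lam ^ B * ((B + 1) * D / lam ^ B) = (B + 1) * D := by field_simp
      linarith

include hp in
theorem value_le_mul (n : ℕ) (y : stdSimplex ℝ (Fin (B + 1)) × Set.Icc 1 D) :
    value p hB hlam n y ≤ n * (p * D) := by
  induction n with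
  | zero => simp [value]
  | succ n ih =>
    have := value_succ_le hB hlam hp n y
    push_cast; linarith

include hp in
/-- Without energy arrivals, each unit of charge saves a bounded cost. -/
theorem value_point_ge (h0 : lam = 0) (n : ℕ) (j : Fin (B + 1)) (x : Set.Icc 1 D) :
    n * (p * D) - (j.1 : ℝ) * D ^ 2 - D * (1 + D - (x.1 : ℝ)) ≤
      value p hB hlam n (pointBelief j, x) := by
  subst h0
  have hwait : ∀ β : stdSimplex ℝ (Fin (B + 1)), waitBelief hlam β = β := by
    intro β
    have : Lam B (0 : ℝ) = 1 := by
      ext i k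
      simp only [Lam, Matrix.of_apply, Matrix.one_apply]
      split_ifs <;> simp
    ext i
    simp [waitBelief, this]
  have hsent : ∀ b : Fin (B + 1), sentBelief hB hlam b = pointBelief ⟨b.1 - 1, by omega⟩ := by
    intro b
    refine Subtype.ext (funext fun i => ?_)
    simp only [sentBelief, rho, pointBelief, Pi.single_apply, Fin.ext_iff]
    split_ifs <;> first | (exfalso; omega) | simp
  have hD0 : (0 : ℝ) ≤ D := Nat.cast_nonneg _
  induction n generalizing j x with
  | zero =>
    have hxD : (x.1 : ℝ) ≤ D := by exact_mod_cast x.2.2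
    have : (0 : ℝ) ≤ (j.1 : ℝ) * D ^ 2 := by positivity
    have : (0 : ℝ) ≤ D * (1 + D - (x.1 : ℝ)) := mul_nonneg hD0 (by linarith)
    simp only [value, Function.iterate_zero, id]
    push_cast; linarith
  | succ n ih =>
    have hxD : (x.1 : ℝ) ≤ D := by exact_mod_cast x.2.2
    -- For a slot without update: either the age is capped and the slot costs `r * D` in full, or
    -- the growing age releases an allowance of `D`, enough for any shortfall.
    have hkey : ∀ r ∈ Set.Icc (0 : ℝ) 1, r * D - D * (1 + D - (x.1 : ℝ)) ≤
        r * ((ageStep x).1 : ℝ) - D * (1 + D - ((ageStep x).1 : ℝ)) := by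
      intro r hr
      rcases lt_or_eq_of_le x.2.2 with hx | hx
      · have hst : ((ageStep x).1 : ℝ) = x.1 + 1 := by
          simp only [ageStep]; rw [min_eq_left (by omega)]; push_cast; rfl
        have h1 : 0 ≤ r * ((ageStep x).1 : ℝ) := mul_nonneg hr.1 (Nat.cast_nonneg _)
        have h2 : r * D ≤ D := mul_le_of_le_one_left hD0 hr.2
        rw [hst] at h1 ⊢
        linarith
      · have hst : ageStep x = x := Subtype.ext (by simp only [ageStep]; omega)
        rw [hst, show (x.1 : ℝ) = D by exact_mod_cast hx]
    rw [value_succ]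
    have := le_bellman hB hlam hp (u := value p hB hlam n) (y := (pointBelief j, x))
      (c := n * (p * D) - (j.1 : ℝ) * D ^ 2 - D * (1 + D - (x.1 : ℝ))) (d := D)
      (fun r hr => by
        simp only [waitValue, hwait]
        linarith [ih j (ageStep x), hkey r hr])
      (fun r hr => by
        rw [sendValue_pointBelief, sendOutcome]
        split_ifs with hj
        · have h1 := ih 0 (ageStep x)
          rw [hsent]
          subst hj
          have h2 := hkey r hr
          simp only [Fin.val_zero, Nat.cast_zero, zero_mul, sub_zero, Nat.zero_sub] at h1 ⊢
          change _ ≤ r * _ + value p hB hlam n (pointBelief 0, ageStep x)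
          linarith
        -- The spent charge releases `D ^ 2`, exactly the age allowance needed after the reset to
        -- age one. The former age allowance, at least `D`, pays for the saving in this slot.
        · have hj0 : 1 ≤ j.1 := Nat.one_le_iff_ne_zero.2 fun h => hj (Fin.ext h)
          have h1 := ih ⟨j.1 - 1, by omega⟩ (ageOne x)
          rw [hsent]
          simp only [ageOne, Nat.cast_sub hj0, Nat.cast_one] at h1 ⊢
          have h2 : r * D ≤ D := mul_le_of_le_one_left hD0 hr.2
          have h3 : 0 ≤ (D : ℝ) * (D - x.1) := mul_nonneg hD0 (by linarith)
          nlinarith [hr.1])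
    push_cast
    linarith

include hp in
/-- The finite-horizon values have uniformly bounded oscillation. -/
theorem exists_value_bound (hD : 1 ≤ D) : ∃ (G : ℕ → ℝ) (K : ℝ),
    ∀ (n : ℕ) (y : stdSimplex ℝ (Fin (B + 1)) × Set.Icc 1 D),
      |value p hB hlam n y - G n| ≤ K := by
  have hD0 : (0 : ℝ) ≤ D := Nat.cast_nonneg _
  have hlo : ∀ n (y : stdSimplex ℝ (Fin (B + 1)) × Set.Icc 1 D),
      value p hB hlam n (pointBelief (Fin.last B), ageOne (ageTop hD)) ≤ value p hB hlam n y :=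
    fun n y => value_anti hB hlam hp n (stochLE_single_last y.1.2) (ageOne_le _ y.2)
  rcases hlam.1.eq_or_lt with h0 | hpos
  · refine ⟨fun n => n * (p * D), B * D ^ 2 + D * D, fun n y => ?_⟩
    have h1 := value_point_ge hB hlam hp h0.symm n (Fin.last B) (ageOne (ageTop hD))
    have h2 := value_le_mul hB hlam hp n y
    have h3 := hlo n y
    have h4 : (0 : ℝ) ≤ B * D ^ 2 + D * D := by positivity
    simp only [ageOne, Nat.cast_one, Fin.val_last] at h1 h3
    rw [abs_le]
    constructor <;> linarith
  · refine ⟨fun n => value p hB hlam n (sentBelief hB hlam (Fin.last B), ageOne (ageTop hD)),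
      (B + 1) * D / lam ^ B + D * D, fun n y => ?_⟩
    have h1 := value_zero_le hB hlam hp hD hpos n
    have h2 := value_last_ge hB hlam hp n (ageOne (ageTop hD))
    have h3 := hlo n y
    have h4 : (0 : ℝ) ≤ (B + 1) * D / lam ^ B := by positivity
    have h5 : (0 : ℝ) ≤ D * D := by positivity
    have h6 : value p hB hlam n y ≤ value p hB hlam n (pointBelief 0, ageTop hD) :=
      value_anti hB hlam hp n (single_zero_stochLE y.1.2) (le_ageTop hD y.2)
    simp only [ageOne, Nat.cast_one] at h1 h2 h3 ⊢
    rw [abs_le]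
    constructor <;> linarith

end

/-! ### From the reduced problem to the Bellman equation, and uniqueness of its constant. -/

theorem cast_ageStep (x : Set.Icc 1 D) : ((ageStep x).1 : ℝ) = min ((x.1 : ℝ) + 1) (D : ℝ) := by
  simp [ageStep]

theorem Q_zero (h : BeliefState B D → ℝ) (β : Belief B) (r : Fin 2) (x : Set.Icc 1 D)
    (k : Set.Icc 1 B) :
    Q p lam h (β, r, x, k) 0 = ((r : ℕ) : ℝ) * ((ageStep x).1 : ℝ) +
      (p * h ((Lam B lam).mulVec β, 1, ageStep x, k) +
        (1 - p) * h ((Lam B lam).mulVec β, 0, ageStep x, k)) := by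
  simp only [Q, if_true, Fin.sum_univ_two, cast_ageStep]
  simp; ring

/-- Total mass one allows the success cost `r * (1 - β 0)` to be distributed over the levels, so
that `Q` becomes an average over outcomes. -/
theorem Q_one (h : BeliefState B D → ℝ) {β : Belief B} (hβ : ∑ i, β i = 1) (r : Fin 2)
    (x : Set.Icc 1 D) (k : Set.Icc 1 B) :
    Q p lam h (β, r, x, k) 1 =
      β 0 * (((r : ℕ) : ℝ) * ((ageStep x).1 : ℝ) +
        (p * h (rho B lam 0, 1, ageStep x, k) + (1 - p) * h (rho B lam 0, 0, ageStep x, k))) +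
      ∑ j : Set.Icc 1 B, β (level j) * (((r : ℕ) : ℝ) +
        (p * h (rho B lam j.1, 1, ageOne x, j) + (1 - p) * h (rho B lam j.1, 0, ageOne x, j))) := by
  have hs : ∑ j : Set.Icc 1 B, β (level j) = 1 - β 0 := by
    rw [sum_eq_zero_add_level] at hβ; linarith
  simp only [Q, Fin.sum_univ_two, cast_ageStep, mul_add (β (level _)), Finset.sum_add_distrib,
    ← Finset.sum_mul, hs]
  rw [if_neg (by decide)]
  simp; ring

/-- The Bellman equation has a bounded solution on the space of all beliefs. -/
theorem exists_solvesBellman (hB : 1 ≤ B) (hD : 1 ≤ D) (hp : p ∈ Set.Icc (0 : ℝ) 1)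
    (hlam : lam ∈ Set.Icc (0 : ℝ) 1) :
    ∃ (C : ℝ) (h : BeliefState B D → ℝ), BoundedOn (stdSimplex ℝ (Fin (B + 1))) h ∧
      SolvesBellman p lam (stdSimplex ℝ (Fin (B + 1))) C h := by
  classical
  obtain ⟨G, K, hGK⟩ := exists_value_bound (D := D) hB hlam hp hD
  have : Nonempty (stdSimplex ℝ (Fin (B + 1)) × Set.Icc 1 D) := ⟨(pointBelief 0, ageTop hD)⟩
  obtain ⟨C, u, ⟨M, hM⟩, hu⟩ := exists_average_solution (bellman (D := D) p hB hlam)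
    (bellman_mono hB hlam hp) (bellman_add_const hB hlam) (bellman_tendsto hB hlam) G K hGK
  set q : Fin 2 → stdSimplex ℝ (Fin (B + 1)) × Set.Icc 1 D → ℝ := fun r y =>
    min (waitValue hlam u ((r : ℕ) : ℝ) y) (sendValue hB hlam u ((r : ℕ) : ℝ) y) with hq
  -- The request is restored by performing the minimization for each `r` separately; the average
  -- over `r` is then `T u - C = u`, so `Q` of `h` reproduces the reduced values. The value `0` off
  -- the simplex is never used.
  set h : BeliefState B D → ℝ := fun z =>
    if hz : z.1 ∈ stdSimplex ℝ (Fin (B + 1)) then q z.2.1 (⟨z.1, hz⟩, z.2.2.1) - C else 0 with hh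
  have hval : ∀ (β : stdSimplex ℝ (Fin (B + 1))) r x k,
      h (β.1, r, x, k) = q r (β, x) - C := fun β r x k => by
    simp only [hh]; rw [dif_pos β.2]
  have havg : ∀ (β : stdSimplex ℝ (Fin (B + 1))) x k,
      p * h (β.1, 1, x, k) + (1 - p) * h (β.1, 0, x, k) = u (β, x) := by
    intro β x k
    have h1 := hu (β, x)
    simp only [bellman] at h1
    simp only [hval, hq]
    simp only [Fin.val_one, Fin.val_zero, Nat.cast_one, Nat.cast_zero]
    linarith
  have hQ0 : ∀ (β : stdSimplex ℝ (Fin (B + 1))) r x k,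
      Q p lam h (β.1, r, x, k) 0 = waitValue hlam u ((r : ℕ) : ℝ) (β, x) := by
    intro β r x k
    rw [Q_zero]
    exact congrArg _ (havg (waitBelief hlam β) (ageStep x) k)
  have hQ1 : ∀ (β : stdSimplex ℝ (Fin (B + 1))) r x k,
      Q p lam h (β.1, r, x, k) 1 = sendValue hB hlam u ((r : ℕ) : ℝ) (β, x) := by
    intro β r x k
    rw [Q_one h β.2.2, sendValue, sum_eq_zero_add_level]
    congr 1
    · simp only [sendOutcome, if_true]
      rw [← havg (sentBelief hB hlam 0) (ageStep x) k]
      rfl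
    · refine Finset.sum_congr rfl fun j _ => ?_
      have hj : level j ≠ 0 := fun h0 => by
        have h1 := congrArg Fin.val h0
        have := j.2.1
        simp only [level, Fin.val_zero] at h1
        omega
      simp only [sendOutcome, if_neg hj]
      rw [← havg (sentBelief hB hlam (level j)) (ageOne x) j]
      rfl
  refine ⟨C, h, ⟨D + M + |C|, ?_⟩, ?_⟩
  · rintro ⟨β, r, x, k⟩ hβ
    rw [hval ⟨β, hβ⟩]
    have hr : ((r : ℕ) : ℝ) ∈ Set.Icc (0 : ℝ) 1 := by
      constructor
      · positivity
      · have : (r : ℕ) ≤ 1 := by omega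
        exact_mod_cast this
    have hrage : 0 ≤ ((r : ℕ) : ℝ) * ((ageStep x).1 : ℝ) := by positivity
    have hrageD : ((r : ℕ) : ℝ) * ((ageStep x).1 : ℝ) ≤ D :=
      (mul_le_of_le_one_left (Nat.cast_nonneg _) hr.2).trans (ageStep_le _)
    have hrD : ((r : ℕ) : ℝ) ≤ D := hr.2.trans (one_le_D x)
    have hw : |waitValue hlam u ((r : ℕ) : ℝ) (⟨β, hβ⟩, x)| ≤ D + M := by
      have := abs_le.1 (hM (waitBelief hlam ⟨β, hβ⟩, ageStep x))
      rw [abs_le, waitValue]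
      constructor <;> linarith [this.1, this.2]
    have hs : |sendValue hB hlam u ((r : ℕ) : ℝ) (⟨β, hβ⟩, x)| ≤ D + M := by
      have hout : ∀ b, |sendOutcome hB hlam u ((r : ℕ) : ℝ) x b| ≤ D + M := by
        intro b
        rw [sendOutcome]
        split_ifs
        · have := abs_le.1 (hM (sentBelief hB hlam 0, ageStep x))
          rw [abs_le]
          constructor <;> linarith [this.1, this.2]
        · have := abs_le.1 (hM (sentBelief hB hlam b, ageOne x))
          rw [abs_le]
          constructor <;> linarith [this.1, this.2, hr.1]
      calc |sendValue hB hlam u ((r : ℕ) : ℝ) (⟨β, hβ⟩, x)|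
          ≤ ∑ b, |β b * sendOutcome hB hlam u ((r : ℕ) : ℝ) x b| := Finset.abs_sum_le_sum_abs _ _
        _ ≤ ∑ b, β b * (D + M) := Finset.sum_le_sum fun b _ => by
            rw [abs_mul, abs_of_nonneg (hβ.1 b)]
            exact mul_le_mul_of_nonneg_left (hout b) (hβ.1 b)
        _ = D + M := by rw [← Finset.sum_mul, hβ.2, one_mul]
    have hqb : |q r (⟨β, hβ⟩, x)| ≤ D + M := by
      rw [abs_le] at hw hs ⊢
      exact ⟨le_min hw.1 hs.1, (min_le_left _ _).trans hw.2⟩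
    exact (abs_sub _ _).trans (by linarith)
  · rintro ⟨β, r, x, k⟩ hβ
    rw [hval ⟨β, hβ⟩, hQ0 ⟨β, hβ⟩, hQ1 ⟨β, hβ⟩]
    simp only [hq]
    ring

theorem Q_le_add {S : Set (Belief B)} (hp : p ∈ Set.Icc (0 : ℝ) 1) (hS : IsBeliefSpace lam S)
    {h h' : BeliefState B D → ℝ} {c : ℝ} (hc : ∀ z : BeliefState B D, z.1 ∈ S → h z ≤ h' z + c)
    {z : BeliefState B D} (hz : z.1 ∈ S) (a : Action) : Q p lam h z a ≤ Q p lam h' z a + c := by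
  obtain ⟨β, r, x, k⟩ := z
  have havg : ∀ γ ∈ S, ∀ (x : Set.Icc 1 D) (k : Set.Icc 1 B),
      p * h (γ, 1, x, k) + (1 - p) * h (γ, 0, x, k) ≤
        p * h' (γ, 1, x, k) + (1 - p) * h' (γ, 0, x, k) + c := by
    intro γ hγ x k
    have h1 := mul_le_mul_of_nonneg_left (hc (γ, 1, x, k) hγ) hp.1
    have h0 := mul_le_mul_of_nonneg_left (hc (γ, 0, x, k) hγ) (sub_nonneg.2 hp.2)
    linarith
  have hβ := hS.1 hz
  fin_cases a
  · change Q p lam h (β, r, x, k) 0 ≤ Q p lam h' (β, r, x, k) 0 + c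
    rw [Q_zero, Q_zero]
    linarith [havg _ (hS.2.2 β hz) (ageStep x) k]
  · change Q p lam h (β, r, x, k) 1 ≤ Q p lam h' (β, r, x, k) 1 + c
    rw [Q_one h hβ.2, Q_one h' hβ.2]
    have hs : ∑ j : Set.Icc 1 B, β (level j) = 1 - β 0 := by
      have := hβ.2
      rw [sum_eq_zero_add_level] at this; linarith
    have h0 := mul_le_mul_of_nonneg_left
      (havg _ (hS.2.1 0 (Nat.zero_le _)) (ageStep x) k) (hβ.1 0)
    have h1 : ∑ j : Set.Icc 1 B, β (level j) * (((r : ℕ) : ℝ) +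
        (p * h (rho B lam j.1, 1, ageOne x, j) + (1 - p) * h (rho B lam j.1, 0, ageOne x, j))) ≤
      ∑ j : Set.Icc 1 B, (β (level j) * (((r : ℕ) : ℝ) +
        (p * h' (rho B lam j.1, 1, ageOne x, j) + (1 - p) * h' (rho B lam j.1, 0, ageOne x, j))) +
        β (level j) * c) := Finset.sum_le_sum fun j _ => by
      rw [← mul_add]
      refine mul_le_mul_of_nonneg_left ?_ (hβ.1 _)
      linarith [havg _ (hS.2.1 j.1 j.2.2) (ageOne x) j]
    rw [Finset.sum_add_distrib, ← Finset.sum_mul, hs] at h1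
    linarith

/-- With `c` the supremum of `h - h'`, subtracting the two equations gives `h - h' ≤ c - (C - C')`
everywhere, hence `C ≤ C'`. No policy enters, so the argument also covers `D = 1`. -/
theorem SolvesBellman.const_le {S : Set (Belief B)} (hB : 1 ≤ B) (hD : 1 ≤ D)
    (hp : p ∈ Set.Icc (0 : ℝ) 1) (hS : IsBeliefSpace lam S) {C C' : ℝ}
    {h h' : BeliefState B D → ℝ} (hb : BoundedOn S h) (hb' : BoundedOn S h')
    (hh : SolvesBellman p lam S C h) (hh' : SolvesBellman p lam S C' h') : C ≤ C' := by
  obtain ⟨K, hK⟩ := hb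
  obtain ⟨K', hK'⟩ := hb'
  set Z : Set (BeliefState B D) := {z | z.1 ∈ S} with hZ
  set A : Set ℝ := (fun z => h z - h' z) '' Z with hA
  have hbdd : BddAbove A := ⟨K + K', by
    rintro _ ⟨z, hz, rfl⟩
    have h1 := (abs_le.1 (hK z hz)).2
    have h2 := (abs_le.1 (hK' z hz)).1
    simp only; linarith⟩
  have hne : A.Nonempty := ⟨_, (rho B lam 0, 0, ⟨1, le_rfl, hD⟩, ⟨1, le_rfl, hB⟩),
    hS.2.1 0 (Nat.zero_le _), rfl⟩
  have hc : ∀ z : BeliefState B D, z.1 ∈ S → h z ≤ h' z + sSup A := fun z hz => by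
    have := le_csSup hbdd ⟨z, hz, rfl⟩
    simp only at this; linarith
  have hsup : sSup A ≤ sSup A - (C - C') := csSup_le hne (by
    rintro _ ⟨z, hz, rfl⟩
    have h1 := hh z hz
    have h2 := hh' z hz
    have h3 := min_le_min (Q_le_add hp hS hc hz 0) (Q_le_add hp hS hc hz 1)
    rw [min_add_add_right] at h3
    simp only; linarith)
  linarith

theorem SolvesBellman.const_unique {S : Set (Belief B)} (hB : 1 ≤ B) (hD : 1 ≤ D)
    (hp : p ∈ Set.Icc (0 : ℝ) 1) (hS : IsBeliefSpace lam S) {C C' : ℝ}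
    {h h' : BeliefState B D → ℝ} (hb : BoundedOn S h) (hb' : BoundedOn S h')
    (hh : SolvesBellman p lam S C h) (hh' : SolvesBellman p lam S C' h') : C = C' :=
  le_antisymm (hh.const_le hB hD hp hS hb hb' hh') (hh'.const_le hB hD hp hS hb' hb hh)

/-! ### One step of the filter -/

/-- The unnormalized conditional law of the battery level after action `a` and next observation
`o'`. -/
noncomputable def filterStep (p lam : ℝ) (β : Belief B) (o : Obs B D) (a : Action)
    (o' : Obs B D) : Belief B :=
  fun j => ∑ b : Fin (B + 1), β b * transProb p lam (b, o) a (j, o')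

theorem obsProb_eq_sum_filterStep (z : BeliefState B D) (a : Action) (o' : Obs B D) :
    obsProb p lam z a o' = ∑ j, filterStep p lam z.1 z.2 a o' j := by
  simp only [obsProb, filterStep, Finset.mul_sum]
  exact Finset.sum_comm

theorem obsProb_of_filterStep {z : BeliefState B D} {a : Action} {o' : Obs B D} {c : ℝ}
    {γ : Belief B} (hγ : ∑ j, γ j = 1) (h : ∀ j, filterStep p lam z.1 z.2 a o' j = c * γ j) :
    obsProb p lam z a o' = c := by
  rw [obsProb_eq_sum_filterStep]
  simp only [h, ← Finset.mul_sum, hγ, mul_one]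

theorem bayesUpdate_of_filterStep {z : BeliefState B D} {a : Action} {o' : Obs B D} {c : ℝ}
    {γ : Belief B} (hγ : ∑ j, γ j = 1) (h : ∀ j, filterStep p lam z.1 z.2 a o' j = c * γ j)
    (hc : c ≠ 0) : bayesUpdate p lam z a o' = γ := by
  funext j
  have h1 := h j
  simp only [filterStep] at h1
  simp only [bayesUpdate, obsProb_of_filterStep hγ h, h1]
  field_simp

/-- The factor `obsProb` cancels the arbitrary value that Bayes' rule takes on observations of
probability zero. -/
theorem obsProb_mul_bayesUpdate {z : BeliefState B D} {a : Action} {o' : Obs B D} {c : ℝ}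
    {γ : Belief B} (hγ : ∑ j, γ j = 1) (h : ∀ j, filterStep p lam z.1 z.2 a o' j = c * γ j)
    (φ : BeliefState B D → ℝ) :
    obsProb p lam z a o' * φ (bayesUpdate p lam z a o', o') = c * φ (γ, o') := by
  rw [obsProb_of_filterStep hγ h]
  by_cases hc : c = 0
  · simp [hc]
  · rw [bayesUpdate_of_filterStep hγ h hc]

theorem filterStep_zero (β : Belief B) (r r' : Fin 2) (x x' : Set.Icc 1 D) (k k' : Set.Icc 1 B)
    (j : Fin (B + 1)) :
    filterStep p lam β (r, x, k) 0 (r', x', k') j =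
      (requestProb p r' * if x' = ageStep x ∧ k' = k then 1 else 0) *
        (Lam B lam).mulVec β j := by
  simp only [filterStep, transProb, batteryProb_zero, knowledgeProb, Matrix.mulVec, dotProduct,
    Finset.mul_sum]
  refine Finset.sum_congr rfl fun b _ => ?_
  rw [if_neg (by simp)]
  ring

/-- The two terms are failure and success. They can both be nonzero for the same observation only if
`ageStep x` equals one, which `D ≥ 2` excludes. -/
theorem filterStep_one (β : Belief B) (r r' : Fin 2) (x x' : Set.Icc 1 D) (k k' : Set.Icc 1 B)
    (j : Fin (B + 1)) :
    filterStep p lam β (r, x, k) 1 (r', x', k') j =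
      (requestProb p r' * if x' = ageStep x ∧ k' = k then β 0 else 0) * rho B lam 0 j +
        (requestProb p r' * if x'.1 = 1 then β (level k') else 0) * rho B lam k'.1 j := by
  rw [filterStep, sum_eq_zero_add_level]
  congr 1
  · simp only [transProb, batteryProb_one, knowledgeProb]
    rw [if_neg (by simp)]
    split_ifs <;> simp; ring
  · rw [Finset.sum_eq_single k']
    · simp only [transProb, batteryProb_one, knowledgeProb, level]
      rw [if_pos ⟨trivial, k'.2.1⟩]
      split_ifs <;> simp_all; ring
    · intro i _ hi
      have : k'.1 ≠ i.1 := fun h => hi (Subtype.ext h.symm)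
      have hk : knowledgeProb (level i) x k 1 x' k' = 0 := by
        rw [knowledgeProb, if_pos ⟨rfl, i.2.1⟩, if_neg (fun h => this h.2)]
      simp only [transProb, hk, mul_zero]
    · simp

theorem cost_zero (b : Fin (B + 1)) (r : Fin 2) (x : Set.Icc 1 D) (k : Set.Icc 1 B) :
    cost (b, r, x, k) 0 = ((r : ℕ) : ℝ) * ((ageStep x).1 : ℝ) := by
  simp [cost, cast_ageStep]

theorem cost_one_zero (r : Fin 2) (x : Set.Icc 1 D) (k : Set.Icc 1 B) :
    cost ((0 : Fin (B + 1)), r, x, k) 1 = ((r : ℕ) : ℝ) * ((ageStep x).1 : ℝ) := by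
  simp [cost, cast_ageStep]

theorem cost_one_level (j : Set.Icc 1 B) (r : Fin 2) (x : Set.Icc 1 D) (k : Set.Icc 1 B) :
    cost (level j, r, x, k) 1 = ((r : ℕ) : ℝ) := by
  have h : 1 ≤ (level j).1 := j.2.1
  simp only [cost, h, and_self, if_true]
  rw [min_eq_left (by have := one_le_D x; linarith)]
  ring

theorem ageStep_ne_one (hD : 2 ≤ D) (x : Set.Icc 1 D) : (ageStep x).1 ≠ 1 := by
  have := x.2.1
  simp only [ageStep]; omega

theorem sum_requestProb_mul (φ : Fin 2 → ℝ) :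
    ∑ r, requestProb p r * φ r = p * φ 1 + (1 - p) * φ 0 := by
  simp [Fin.sum_univ_two, requestProb]; ring

theorem sum_obs_step (x : Set.Icc 1 D) (k : Set.Icc 1 B) (c : ℝ) (φ : Obs B D → ℝ) :
    ∑ o' : Obs B D, (requestProb p o'.1 * if o'.2.1 = ageStep x ∧ o'.2.2 = k then c else 0) * φ o' =
      c * (p * φ (1, ageStep x, k) + (1 - p) * φ (0, ageStep x, k)) := by
  rw [Fintype.sum_prod_type]
  have h : ∀ r : Fin 2, ∑ y : Set.Icc 1 D × Set.Icc 1 B,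
      (requestProb p r * if y.1 = ageStep x ∧ y.2 = k then c else 0) * φ (r, y) =
        requestProb p r * (c * φ (r, ageStep x, k)) := by
    intro r
    rw [Finset.sum_eq_single (ageStep x, k)]
    · simp; ring
    · intro y _ hy
      rw [if_neg (fun h => hy (Prod.ext h.1 h.2))]; ring
    · simp
  simp only [h]
  rw [sum_requestProb_mul (fun r => c * φ (r, ageStep x, k))]
  ring

theorem sum_obs_report (x : Set.Icc 1 D) (c : Set.Icc 1 B → ℝ) (φ : Obs B D → ℝ) :
    ∑ o' : Obs B D, (requestProb p o'.1 * if o'.2.1.1 = 1 then c o'.2.2 else 0) * φ o' =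
      ∑ j, c j * (p * φ (1, ageOne x, j) + (1 - p) * φ (0, ageOne x, j)) := by
  rw [Fintype.sum_prod_type]
  have h : ∀ r : Fin 2, ∑ y : Set.Icc 1 D × Set.Icc 1 B,
      (requestProb p r * if y.1.1 = 1 then c y.2 else 0) * φ (r, y) =
        requestProb p r * ∑ j, c j * φ (r, ageOne x, j) := by
    intro r
    rw [Fintype.sum_prod_type, Finset.sum_eq_single (ageOne x)]
    · simp only [ageOne, if_true, Finset.mul_sum]
      exact Finset.sum_congr rfl fun j _ => by ring
    · intro y _ hy
      refine Finset.sum_eq_zero fun j _ => ?_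
      have h1 : y.1 ≠ 1 := fun h => hy (Subtype.ext h)
      simp only [if_neg h1, mul_zero, zero_mul]
    · simp
  simp only [h]
  rw [sum_requestProb_mul (fun r => ∑ j, c j * φ (r, ageOne x, j)), Finset.mul_sum, Finset.mul_sum,
    ← Finset.sum_add_distrib]
  exact Finset.sum_congr rfl fun j _ => by ring

/-- When the age distinguishes success from failure, `Q` is the action-value function. -/
theorem actionValue_eq_Q (hB : 1 ≤ B) (hD : 2 ≤ D) (h : BeliefState B D → ℝ)
    {z : BeliefState B D} (hz : ∑ j, z.1 j = 1) (a : Action) :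
    actionValue p lam h z a = Q p lam h z a := by
  obtain ⟨β, r, x, k⟩ := z
  simp only at hz
  fin_cases a
  · change actionValue p lam h (β, r, x, k) 0 = Q p lam h (β, r, x, k) 0
    rw [Q_zero, actionValue]
    simp only [cost_zero, ← Finset.sum_mul, hz, one_mul]
    congr 1
    have h1 : ∀ o' : Obs B D, obsProb p lam (β, r, x, k) 0 o' *
        h (bayesUpdate p lam (β, r, x, k) 0 o', o') =
        (requestProb p o'.1 * if o'.2.1 = ageStep x ∧ o'.2.2 = k then 1 else 0) *
          h ((Lam B lam).mulVec β, o') := fun o' =>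
      obsProb_mul_bayesUpdate ((sum_Lam_mulVec β).trans hz)
        (filterStep_zero β r o'.1 x o'.2.1 k o'.2.2) h
    simp only [h1]
    rw [sum_obs_step x k 1 (fun o' => h ((Lam B lam).mulVec β, o')), one_mul]
  · change actionValue p lam h (β, r, x, k) 1 = Q p lam h (β, r, x, k) 1
    rw [Q_one h hz, actionValue, sum_eq_zero_add_level]
    simp only [cost_one_zero, cost_one_level]
    have h1 : ∀ o' : Obs B D, obsProb p lam (β, r, x, k) 1 o' *
        h (bayesUpdate p lam (β, r, x, k) 1 o', o') =
        (requestProb p o'.1 * if o'.2.1 = ageStep x ∧ o'.2.2 = k then β 0 else 0) *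
            h (rho B lam 0, o') +
          (requestProb p o'.1 * if o'.2.1.1 = 1 then β (level o'.2.2) else 0) *
            h (rho B lam o'.2.2.1, o') := by
      rintro ⟨r', x', k'⟩
      by_cases hx : x'.1 = 1
      · have hne : ¬(x' = ageStep x ∧ k' = k) := fun h =>
          ageStep_ne_one hD x (by rw [← h.1]; exact hx)
        simp only [if_neg hne, mul_zero, zero_mul, zero_add]
        refine obsProb_mul_bayesUpdate (sum_rho hB (level k')) (fun j => ?_) h
        rw [filterStep_one, if_neg hne]
        simp only [mul_zero, zero_mul, zero_add]; rfl
      · simp only [if_neg hx, mul_zero, zero_mul, add_zero]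
        refine obsProb_mul_bayesUpdate (sum_rho hB 0) (fun j => ?_) h
        rw [filterStep_one, if_neg hx]
        simp only [mul_zero, zero_mul, add_zero]; rfl
    simp only [h1, Finset.sum_add_distrib, mul_add]
    rw [sum_obs_step x k (β 0) (fun o' => h (rho B lam 0, o')),
      sum_obs_report x (fun j => β (level j)) (fun o' => h (rho B lam o'.2.2.1, o'))]
    simp only [mul_add, Finset.sum_add_distrib]
    ring

/-- A belief space is closed under the Bayes rule when the age distinguishes success from failure. -/
theorem bayesUpdate_mem (hD : 2 ≤ D) {S : Set (Belief B)}
    (hS : IsBeliefSpace lam S) {z : BeliefState B D} (hz : z.1 ∈ S) (a : Action) (o' : Obs B D)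
    (ho : obsProb p lam z a o' ≠ 0) : bayesUpdate p lam z a o' ∈ S := by
  obtain ⟨β, r, x, k⟩ := z
  obtain ⟨r', x', k'⟩ := o'
  have key : ∀ (c : ℝ) (γ : Belief B), γ ∈ S → (∀ j, filterStep p lam β (r, x, k) a (r', x', k') j
      = c * γ j) → bayesUpdate p lam (β, r, x, k) a (r', x', k') ∈ S := by
    intro c γ hγ h
    have hs := (hS.1 hγ).2
    have hc : c ≠ 0 := by
      rw [← obsProb_of_filterStep (z := (β, r, x, k)) hs h]; exact ho
    rw [bayesUpdate_of_filterStep (z := (β, r, x, k)) hs h hc]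
    exact hγ
  have ha : a = 0 ∨ a = 1 := by fin_cases a <;> simp
  rcases ha with rfl | rfl
  · exact key _ _ (hS.2.2 β hz) (filterStep_zero β r r' x x' k k')
  · by_cases hx : x'.1 = 1
    · have hne : ¬(x' = ageStep x ∧ k' = k) := fun h =>
        ageStep_ne_one hD x (by rw [← h.1]; exact hx)
      refine key (requestProb p r' * if x'.1 = 1 then β (level k') else 0) _
        (hS.2.1 k'.1 k'.2.2) fun j => ?_
      rw [filterStep_one, if_neg hne, mul_zero, zero_mul, zero_add]
    · refine key (requestProb p r' * if x' = ageStep x ∧ k' = k then β 0 else 0) _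
        (hS.2.1 0 (Nat.zero_le _)) fun j => ?_
      rw [filterStep_one, if_neg hx, mul_zero, zero_mul, add_zero]

/-- The next request is independent of the rest. This form needs no separation of success from
failure, so it serves `D = 1`, and `φ = 1` gives total mass one. -/
theorem sum_obsProb_mul (hB : 1 ≤ B) {z : BeliefState B D} (hz : ∑ j, z.1 j = 1) (a : Action)
    (φ : Fin 2 → ℝ) :
    ∑ o' : Obs B D, obsProb p lam z a o' * φ o'.1 = p * φ 1 + (1 - p) * φ 0 := by
  obtain ⟨β, r, x, k⟩ := z
  simp only at hz
  have ha : a = 0 ∨ a = 1 := by fin_cases a <;> simp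
  rcases ha with rfl | rfl
  · have h1 : ∀ o' : Obs B D, obsProb p lam (β, r, x, k) 0 o' =
        requestProb p o'.1 * if o'.2.1 = ageStep x ∧ o'.2.2 = k then 1 else 0 := fun o' =>
      obsProb_of_filterStep ((sum_Lam_mulVec β).trans hz)
        (filterStep_zero β r o'.1 x o'.2.1 k o'.2.2)
    simp only [h1]
    rw [sum_obs_step x k 1 (fun o' => φ o'.1), one_mul]
  · have h1 : ∀ o' : Obs B D, obsProb p lam (β, r, x, k) 1 o' =
        (requestProb p o'.1 * if o'.2.1 = ageStep x ∧ o'.2.2 = k then β 0 else 0) +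
          (requestProb p o'.1 * if o'.2.1.1 = 1 then β (level o'.2.2) else 0) := by
      rintro ⟨r', x', k'⟩
      rw [obsProb_eq_sum_filterStep]
      simp only [filterStep_one, Finset.sum_add_distrib, ← Finset.mul_sum]
      have e0 := sum_rho (lam := lam) hB 0
      have e1 := sum_rho (lam := lam) hB (level k')
      simp only [Fin.val_zero, level] at e0 e1
      rw [e0, e1, mul_one, mul_one]
    simp only [h1, add_mul, Finset.sum_add_distrib]
    rw [sum_obs_step x k (β 0) (fun o' => φ o'.1),
      sum_obs_report x (fun j => β (level j)) (fun o' => φ o'.1)]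
    simp only []
    rw [← Finset.sum_mul, ← add_mul, ← sum_eq_zero_add_level, hz, one_mul]

theorem transProb_nonneg (hp : p ∈ Set.Icc (0 : ℝ) 1) (hlam : lam ∈ Set.Icc (0 : ℝ) 1)
    (s s' : State B D) (a : Action) : 0 ≤ transProb p lam s a s' := by
  have h1 : 0 ≤ requestProb p s'.2.1 := by
    have := hp.1; have := hp.2
    simp only [requestProb]; split_ifs <;> linarith
  have h2 : 0 ≤ batteryProb lam s.1 a s'.1 := by
    have ha : a = 0 ∨ a = 1 := by fin_cases a <;> simp
    rcases ha with rfl | rfl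
    · rw [batteryProb_zero]; exact Lam_nonneg hlam _ _
    · rw [batteryProb_one]; exact rho_nonneg hlam _ _
  have h3 : 0 ≤ knowledgeProb s.1 s.2.2.1 s.2.2.2 a s'.2.2.1 s'.2.2.2 := by
    simp only [knowledgeProb]; split_ifs <;> norm_num
  exact mul_nonneg (mul_nonneg h1 h2) h3

theorem bayesUpdate_mem_stdSimplex (hp : p ∈ Set.Icc (0 : ℝ) 1) (hlam : lam ∈ Set.Icc (0 : ℝ) 1)
    {z : BeliefState B D} (hz : z.1 ∈ stdSimplex ℝ (Fin (B + 1))) (a : Action) (o' : Obs B D)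
    (ho : obsProb p lam z a o' ≠ 0) :
    bayesUpdate p lam z a o' ∈ stdSimplex ℝ (Fin (B + 1)) := by
  have hnn : ∀ j, 0 ≤ filterStep p lam z.1 z.2 a o' j := fun j =>
    Finset.sum_nonneg fun b _ => mul_nonneg (hz.1 b) (transProb_nonneg hp hlam _ _ _)
  have hob := obsProb_eq_sum_filterStep (p := p) (lam := lam) z a o'
  refine ⟨fun j => div_nonneg (hnn j) ?_, ?_⟩
  · rw [hob]; exact Finset.sum_nonneg fun j _ => hnn j
  · change ∑ j, filterStep p lam z.1 z.2 a o' j / obsProb p lam z a o' = 1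
    rw [← Finset.sum_div, ← hob, div_self ho]

theorem actionValue_of_age_one (hB : 1 ≤ B) (hD : D = 1) {z : BeliefState B D}
    (hz : ∑ j, z.1 j = 1) (a : Action) :
    actionValue p lam (fun z => ((z.2.1 : ℕ) : ℝ)) z a = p + ((z.2.1 : ℕ) : ℝ) := by
  subst hD
  have hc : ∀ b, cost (b, z.2) a = ((z.2.1 : ℕ) : ℝ) := by
    intro b
    have hx : (0 : ℝ) ≤ ((z.2.2.1.1 : ℕ) : ℝ) := Nat.cast_nonneg _
    simp only [cost]
    rw [min_eq_right, Nat.cast_one, mul_one]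
    split_ifs <;> simp
  simp only [actionValue, hc, ← Finset.sum_mul, hz]
  rw [sum_obsProb_mul hB hz a fun r => ((r : ℕ) : ℝ)]
  simp; ring

theorem Q_of_age_one (hD : D = 1) {z : BeliefState B D} (hz : ∑ j, z.1 j = 1) (a : Action) :
    Q p lam (fun z => ((z.2.1 : ℕ) : ℝ)) z a = p + ((z.2.1 : ℕ) : ℝ) := by
  subst hD
  obtain ⟨β, r, x, k⟩ := z
  simp only at hz
  have hx : (ageStep x).1 = 1 := le_antisymm (ageStep x).2.2 (ageStep x).2.1
  have ha : a = 0 ∨ a = 1 := by fin_cases a <;> simp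
  rcases ha with rfl | rfl
  · rw [Q_zero, hx]; simp; ring
  · rw [Q_one _ hz, hx]
    simp only [← Finset.sum_mul]
    have hs : ∑ j : Set.Icc 1 B, β (level j) = 1 - β 0 := by
      rw [sum_eq_zero_add_level] at hz; linarith
    rw [hs]; simp; ring

noncomputable section

/-! ### The filter along histories -/

theorem sum_snoc {α : Type*} [Fintype α] {n : ℕ} (φ : (Fin (n + 1) → α) → ℝ) :
    ∑ f, φ f = ∑ f : Fin n → α, ∑ a : α, φ (Fin.snoc (α := fun _ => α) f a) := by
  rw [← (Fin.snocEquiv fun _ : Fin (n + 1) => α).sum_comp φ, Fintype.sum_prod_type,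
    Finset.sum_comm]
  rfl

theorem observe_snoc {t : ℕ} (s : Traj B D t) (s' : State B D) :
    observe (t := t + 1) (Fin.snoc (α := fun _ => State B D) s s') =
      Fin.snoc (α := fun _ => Obs B D) (observe s) s'.2 := by
  funext i
  refine Fin.lastCases ?_ (fun i => ?_) i
  · simp [observe]
  · simp [observe]

/-- The joint probability of the history `o` and the current battery level. -/
def historyFilter (p lam : ℝ) (z₀ : BeliefState B D) (g : Policy B D) (t : ℕ)
    (o : Fin (t + 1) → Obs B D) : Belief B :=
  fun j => ∑ s : Traj B D t,
    if observe s = o ∧ (s (Fin.last t)).1 = j then trajProb p lam z₀ g t s else 0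

/-- The probability of the history `o`. -/
def historyProb (p lam : ℝ) (z₀ : BeliefState B D) (g : Policy B D) (t : ℕ)
    (o : Fin (t + 1) → Obs B D) : ℝ :=
  ∑ s : Traj B D t, if observe s = o then trajProb p lam z₀ g t s else 0

/-- The belief-state after the history `o`. -/
def historyState (p lam : ℝ) (z₀ : BeliefState B D) (g : Policy B D) (t : ℕ)
    (o : Fin (t + 1) → Obs B D) : BeliefState B D :=
  (posterior (trajProb p lam z₀ g t) o, o (Fin.last t))

variable (z₀ : BeliefState B D) (g : Policy B D)

theorem posterior_apply (t : ℕ) (o : Fin (t + 1) → Obs B D) (j : Fin (B + 1)) :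
    posterior (trajProb p lam z₀ g t) o j =
      historyFilter p lam z₀ g t o j / historyProb p lam z₀ g t o := rfl

/-- Sums over trajectories that depend only on the observations and the current battery level. -/
theorem sum_trajProb_mul (t : ℕ) (φ : (Fin (t + 1) → Obs B D) → Fin (B + 1) → ℝ) :
    ∑ s : Traj B D t, trajProb p lam z₀ g t s * φ (observe s) (s (Fin.last t)).1 =
      ∑ o, ∑ j, historyFilter p lam z₀ g t o j * φ o j := by
  simp only [historyFilter, Finset.sum_mul]
  have h : ∀ o : Fin (t + 1) → Obs B D, ∑ j, ∑ s : Traj B D t,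
      (if observe s = o ∧ (s (Fin.last t)).1 = j then trajProb p lam z₀ g t s else 0) * φ o j =
        ∑ s : Traj B D t, if observe s = o then
          trajProb p lam z₀ g t s * φ (observe s) (s (Fin.last t)).1 else 0 := by
    intro o
    rw [Finset.sum_comm]
    refine Finset.sum_congr rfl fun s _ => ?_
    by_cases ho : observe s = o
    · simp [ho, ite_mul]
    · simp [ho]
  simp only [h]
  rw [Finset.sum_comm]
  simp

theorem sum_historyFilter (t : ℕ) (o : Fin (t + 1) → Obs B D) :
    ∑ j, historyFilter p lam z₀ g t o j = historyProb p lam z₀ g t o := by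
  simp only [historyFilter, historyProb]
  rw [Finset.sum_comm]
  refine Finset.sum_congr rfl fun s _ => ?_
  by_cases ho : observe s = o <;> simp [ho]

theorem historyFilter_succ (t : ℕ) (o : Fin (t + 1) → Obs B D) (o' : Obs B D) :
    historyFilter p lam z₀ g (t + 1) (Fin.snoc (α := fun _ => Obs B D) o o') =
      filterStep p lam (historyFilter p lam z₀ g t o) (o (Fin.last t)) (g t o) o' := by
  funext j
  simp only [historyFilter, filterStep, Finset.sum_mul]
  rw [sum_snoc, Finset.sum_comm (s := (Finset.univ : Finset (Fin (B + 1))))]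
  refine Finset.sum_congr rfl fun s _ => ?_
  have h1 : ∀ s' : State B D,
      (if observe (t := t + 1) (Fin.snoc (α := fun _ => State B D) s s') =
          Fin.snoc (α := fun _ => Obs B D) o o' ∧
          ((Fin.snoc (α := fun _ => State B D) s s' : Traj B D (t + 1)) (Fin.last (t + 1))).1 = j
        then trajProb p lam z₀ g (t + 1) (Fin.snoc (α := fun _ => State B D) s s') else 0) =
      if s' = (j, o') then (if observe s = o then trajProb p lam z₀ g t s *
        transProb p lam (s (Fin.last t)) (g t o) (j, o') else 0) else 0 := by
    intro s'
    simp only [observe_snoc, Fin.snoc_inj, Fin.snoc_last, trajProb, Fin.init_snoc]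
    by_cases hs : s' = (j, o')
    · subst hs
      by_cases ho : observe s = o
      · simp [ho]
      · simp [ho]
    · have : ¬((observe s = o ∧ s'.2 = o') ∧ s'.1 = j) := fun h => hs (Prod.ext h.2 h.1.2)
      rw [if_neg this, if_neg hs]
  simp only [h1, Finset.sum_ite_eq', Finset.mem_univ, if_true]
  by_cases ho : observe s = o
  · have e : s (Fin.last t) = ((s (Fin.last t)).1, o (Fin.last t)) := by
      rw [← ho]; rfl
    simp only [ho, true_and, if_true, ite_mul, zero_mul, Finset.sum_ite_eq, Finset.mem_univ]
    rw [← e]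
  · simp [ho]

variable (hp : p ∈ Set.Icc (0 : ℝ) 1) (hlam : lam ∈ Set.Icc (0 : ℝ) 1)

include hp hlam in
theorem trajProb_nonneg (hz : z₀.1 ∈ stdSimplex ℝ (Fin (B + 1))) (t : ℕ) (s : Traj B D t) :
    0 ≤ trajProb p lam z₀ g t s := by
  induction t with
  | zero =>
    simp only [trajProb, initProb]
    split_ifs
    · exact hz.1 _
    · exact le_rfl
  | succ t ih =>
    rw [trajProb]
    exact mul_nonneg (ih _) (transProb_nonneg hp hlam _ _ _)

include hp hlam in
theorem historyProb_nonneg (hz : z₀.1 ∈ stdSimplex ℝ (Fin (B + 1))) (t : ℕ)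
    (o : Fin (t + 1) → Obs B D) : 0 ≤ historyProb p lam z₀ g t o :=
  Finset.sum_nonneg fun s _ => by
    split_ifs
    · exact trajProb_nonneg z₀ g hp hlam hz t s
    · exact le_rfl

include hp hlam in
-- On histories of probability zero the joint weights vanish by nonnegativity, so the default
-- posterior is harmless.
theorem historyFilter_eq (hz : z₀.1 ∈ stdSimplex ℝ (Fin (B + 1))) (t : ℕ)
    (o : Fin (t + 1) → Obs B D) (j : Fin (B + 1)) :
    historyFilter p lam z₀ g t o j =
      historyProb p lam z₀ g t o * (historyState p lam z₀ g t o).1 j := by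
  change _ = _ * posterior (trajProb p lam z₀ g t) o j
  rw [posterior_apply]
  by_cases h : historyProb p lam z₀ g t o = 0
  · have hnn : ∀ j, 0 ≤ historyFilter p lam z₀ g t o j := fun j =>
      Finset.sum_nonneg fun s _ => by
        split_ifs
        · exact trajProb_nonneg z₀ g hp hlam hz t s
        · exact le_rfl
    have hs := sum_historyFilter (p := p) (lam := lam) z₀ g t o
    rw [h] at hs
    rw [(Finset.sum_eq_zero_iff_of_nonneg fun j _ => hnn j).1 hs j (Finset.mem_univ j), h]
    simp
  · field_simp

theorem filterStep_smul (c : ℝ) {β γ : Belief B} (h : ∀ j, β j = c * γ j) (o o' : Obs B D)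
    (a : Action) (j : Fin (B + 1)) :
    filterStep p lam β o a o' j = c * filterStep p lam γ o a o' j := by
  simp only [filterStep, h, Finset.mul_sum]
  exact Finset.sum_congr rfl fun b _ => by ring

include hp hlam in
theorem historyProb_succ (hz : z₀.1 ∈ stdSimplex ℝ (Fin (B + 1))) (t : ℕ)
    (o : Fin (t + 1) → Obs B D) (o' : Obs B D) :
    historyProb p lam z₀ g (t + 1) (Fin.snoc (α := fun _ => Obs B D) o o') =
      historyProb p lam z₀ g t o * obsProb p lam (historyState p lam z₀ g t o) (g t o) o' := by
  rw [← sum_historyFilter, historyFilter_succ, obsProb_eq_sum_filterStep, Finset.mul_sum]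
  exact Finset.sum_congr rfl fun j _ =>
    filterStep_smul _ (historyFilter_eq z₀ g hp hlam hz t o) _ _ _ j

include hp hlam in
theorem historyState_succ (hz : z₀.1 ∈ stdSimplex ℝ (Fin (B + 1))) (t : ℕ)
    (o : Fin (t + 1) → Obs B D) (o' : Obs B D) (ho : historyProb p lam z₀ g t o ≠ 0) :
    historyState p lam z₀ g (t + 1) (Fin.snoc (α := fun _ => Obs B D) o o') =
      (bayesUpdate p lam (historyState p lam z₀ g t o) (g t o) o', o') := by
  refine Prod.ext (funext fun j => ?_)
    (Fin.snoc_last (α := fun _ => Obs B D) o' o)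
  change posterior (trajProb p lam z₀ g (t + 1)) _ j = filterStep p lam _ _ _ _ j / _
  rw [posterior_apply, historyFilter_succ, historyProb_succ z₀ g hp hlam hz,
    filterStep_smul _ (historyFilter_eq z₀ g hp hlam hz t o), mul_div_mul_left _ _ ho]
  rfl

theorem historyFilter_zero (o : Fin 1 → Obs B D) (j : Fin (B + 1)) :
    historyFilter p lam z₀ g 0 o j = if o 0 = z₀.2 then z₀.1 j else 0 := by
  simp only [historyFilter, trajProb, initProb]
  rw [Finset.sum_eq_single (fun _ => (j, o 0))]
  · have : observe (B := B) (D := D) (t := 0) (fun _ => (j, o 0)) = o := by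
      funext i; rw [show i = 0 from Fin.fin_one_eq_zero i]; rfl
    simp [this]
  · intro s _ hs
    rw [if_neg]
    rintro ⟨h1, h2⟩
    apply hs
    funext i
    rw [show i = 0 from Fin.fin_one_eq_zero i]
    exact Prod.ext h2 (congrFun h1 0)
  · simp

theorem historyProb_zero (hz : ∑ j, z₀.1 j = 1) (o : Fin 1 → Obs B D) :
    historyProb p lam z₀ g 0 o = if o 0 = z₀.2 then 1 else 0 := by
  rw [← sum_historyFilter]
  simp only [historyFilter_zero]
  split_ifs
  · exact hz
  · simp

include hp hlam in
-- Closure under Bayes' rule is a hypothesis so that both a belief space with `D ≥ 2` and the whole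
-- simplex with any `D` are covered.
theorem historyState_mem {S : Set (Belief B)} (hS : S ⊆ stdSimplex ℝ (Fin (B + 1)))
    (hclosed : ∀ z : BeliefState B D, z.1 ∈ S → ∀ a o', obsProb p lam z a o' ≠ 0 →
      bayesUpdate p lam z a o' ∈ S) (hz : z₀.1 ∈ S) (t : ℕ) (o : Fin (t + 1) → Obs B D)
    (ho : historyProb p lam z₀ g t o ≠ 0) : (historyState p lam z₀ g t o).1 ∈ S := by
  induction t with
  | zero =>
    have h1 := historyProb_zero (p := p) (lam := lam) z₀ g (hS hz).2 o
    have h2 : o 0 = z₀.2 := by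
      by_contra h
      rw [if_neg h] at h1
      exact ho h1
    have : (historyState p lam z₀ g 0 o).1 = z₀.1 := by
      funext j
      change posterior (trajProb p lam z₀ g 0) o j = _
      rw [posterior_apply, historyFilter_zero, h1, if_pos h2, if_pos h2, div_one]
    rw [this]; exact hz
  | succ t ih =>
    have e : o = Fin.snoc (α := fun _ => Obs B D) (Fin.init o) (o (Fin.last (t + 1))) :=
      (Fin.snoc_init_self o).symm
    rw [e] at ho ⊢
    rw [historyProb_succ z₀ g hp hlam (hS hz)] at ho
    have h1 := left_ne_zero_of_mul ho
    rw [historyState_succ z₀ g hp hlam (hS hz) t _ _ h1]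
    exact hclosed _ (ih _ h1) _ _ (right_ne_zero_of_mul ho)

/-- The expectation of a function of the belief-state in the `(t+1)`-st slot. -/
def expectedPotential (p lam : ℝ) (z₀ : BeliefState B D) (g : Policy B D)
    (φ : BeliefState B D → ℝ) (t : ℕ) : ℝ :=
  ∑ o, historyProb p lam z₀ g t o * φ (historyState p lam z₀ g t o)

include hp hlam in
theorem expectedPotential_succ (hz : z₀.1 ∈ stdSimplex ℝ (Fin (B + 1)))
    (φ : BeliefState B D → ℝ) (t : ℕ) :
    expectedPotential p lam z₀ g φ (t + 1) = ∑ o, historyProb p lam z₀ g t o *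
      ∑ o', obsProb p lam (historyState p lam z₀ g t o) (g t o) o' *
        φ (bayesUpdate p lam (historyState p lam z₀ g t o) (g t o) o', o') := by
  rw [expectedPotential, sum_snoc]
  refine Finset.sum_congr rfl fun o _ => ?_
  rw [Finset.mul_sum]
  refine Finset.sum_congr rfl fun o' _ => ?_
  rw [historyProb_succ z₀ g hp hlam hz]
  by_cases ho : historyProb p lam z₀ g t o = 0
  · simp [ho]
  · rw [historyState_succ z₀ g hp hlam hz t o o' ho, mul_assoc]

include hp hlam in
theorem expectedCost_eq (hz : z₀.1 ∈ stdSimplex ℝ (Fin (B + 1))) (t : ℕ) :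
    expectedCost p lam z₀ g t = ∑ o, historyProb p lam z₀ g t o *
      ∑ b, (historyState p lam z₀ g t o).1 b * cost (b, (historyState p lam z₀ g t o).2) (g t o) := by
  have h := sum_trajProb_mul (p := p) (lam := lam) z₀ g t
    fun o j => cost (j, o (Fin.last t)) (g t o)
  refine Eq.trans h (Finset.sum_congr rfl fun o _ => ?_)
  rw [Finset.mul_sum]
  refine Finset.sum_congr rfl fun b _ => ?_
  rw [historyFilter_eq z₀ g hp hlam hz, mul_assoc]
  rfl

include hp hlam in
-- Conditioning on the history turns the partially observed system into the belief-state MDP; all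
-- verification rests on this identity.
theorem expectedCost_add_expectedPotential (hz : z₀.1 ∈ stdSimplex ℝ (Fin (B + 1)))
    (φ : BeliefState B D → ℝ) (t : ℕ) :
    expectedCost p lam z₀ g t + expectedPotential p lam z₀ g φ (t + 1) =
      ∑ o, historyProb p lam z₀ g t o *
        actionValue p lam φ (historyState p lam z₀ g t o) (g t o) := by
  rw [expectedCost_eq z₀ g hp hlam hz, expectedPotential_succ z₀ g hp hlam hz,
    ← Finset.sum_add_distrib]
  exact Finset.sum_congr rfl fun o _ => by rw [actionValue, mul_add]

include hp hlam in
theorem sum_historyProb (hB : 1 ≤ B) (hz : z₀.1 ∈ stdSimplex ℝ (Fin (B + 1))) (t : ℕ) :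
    ∑ o, historyProb p lam z₀ g t o = 1 := by
  induction t with
  | zero =>
    simp only [historyProb_zero z₀ g hz.2]
    rw [Finset.sum_eq_single (fun _ => z₀.2)]
    · simp
    · intro o _ ho
      rw [if_neg]
      intro h
      exact ho (funext fun i => by rw [show i = 0 from Fin.fin_one_eq_zero i]; exact h)
    · simp
  | succ t ih =>
    have h := expectedPotential_succ z₀ g hp hlam hz (fun _ => 1) t
    simp only [expectedPotential, mul_one] at h
    rw [h, ← ih]
    refine Finset.sum_congr rfl fun o _ => ?_
    by_cases ho : historyProb p lam z₀ g t o = 0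
    · simp [ho]
    · have hmem := historyState_mem z₀ g hp hlam subset_rfl
        (fun z hz a o' => bayesUpdate_mem_stdSimplex hp hlam hz a o') hz t o ho
      have := sum_obsProb_mul (p := p) (lam := lam) hB hmem.2 (g t o) fun _ => 1
      simp only [mul_one] at this
      rw [this]; ring

theorem cost_mem_Icc (s : State B D) (a : Action) : cost s a ∈ Set.Icc (0 : ℝ) D := by
  have hr : ((s.2.1 : ℕ) : ℝ) ≤ 1 := by
    have : (s.2.1 : ℕ) ≤ 1 := by omega
    exact_mod_cast this
  have h0 : 0 ≤ min ((1 - (if a = 1 ∧ 1 ≤ s.1.1 then 1 else 0)) * ((s.2.2.1.1 : ℕ) : ℝ) + 1)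
      (D : ℝ) := le_min (by split_ifs <;> (simp; try positivity)) (Nat.cast_nonneg _)
  exact ⟨mul_nonneg (Nat.cast_nonneg _) h0,
    (mul_le_of_le_one_left h0 hr).trans (min_le_right _ _)⟩

include hp hlam in
theorem expectedCost_le (hB : 1 ≤ B) (hz : z₀.1 ∈ stdSimplex ℝ (Fin (B + 1))) (t : ℕ) :
    expectedCost p lam z₀ g t ≤ D := by
  have h1 : ∑ s : Traj B D t, trajProb p lam z₀ g t s = 1 := by
    have := sum_trajProb_mul (p := p) (lam := lam) z₀ g t fun _ _ => 1
    simp only [mul_one, sum_historyFilter] at this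
    rw [this, sum_historyProb z₀ g hp hlam hB hz]
  calc expectedCost p lam z₀ g t ≤ ∑ s : Traj B D t, trajProb p lam z₀ g t s * D :=
        Finset.sum_le_sum fun s _ => mul_le_mul_of_nonneg_left (cost_mem_Icc _ _).2
          (trajProb_nonneg z₀ g hp hlam hz t s)
    _ = D := by rw [← Finset.sum_mul, h1, one_mul]

/-! ### Verification -/

variable {S : Set (Belief B)} (hS : S ⊆ stdSimplex ℝ (Fin (B + 1)))
  (hclosed : ∀ z : BeliefState B D, z.1 ∈ S → ∀ a o', obsProb p lam z a o' ≠ 0 →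
      bayesUpdate p lam z a o' ∈ S) (hz : z₀.1 ∈ S)

include hp hlam hS hclosed hz in
theorem abs_expectedPotential_le (hB : 1 ≤ B) {φ : BeliefState B D → ℝ} {K : ℝ}
    (hK : ∀ z : BeliefState B D, z.1 ∈ S → |φ z| ≤ K) (t : ℕ) :
    |expectedPotential p lam z₀ g φ t| ≤ K := by
  calc |expectedPotential p lam z₀ g φ t|
      ≤ ∑ o, |historyProb p lam z₀ g t o * φ (historyState p lam z₀ g t o)| :=
        Finset.abs_sum_le_sum_abs _ _
    _ ≤ ∑ o, historyProb p lam z₀ g t o * K := Finset.sum_le_sum fun o _ => by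
        have h0 := historyProb_nonneg z₀ g hp hlam (hS hz) t o
        rw [abs_mul, abs_of_nonneg h0]
        by_cases ho : historyProb p lam z₀ g t o = 0
        · simp [ho]
        · exact mul_le_mul_of_nonneg_left
            (hK _ (historyState_mem z₀ g hp hlam hS hclosed hz t o ho)) h0
    _ = K := by rw [← Finset.sum_mul, sum_historyProb z₀ g hp hlam hB (hS hz), one_mul]

include hp hlam hS hclosed hz in
theorem expectedCost_ge_of_supersolution (hB : 1 ≤ B) {φ : BeliefState B D → ℝ} {C : ℝ}
    (hφ : ∀ z : BeliefState B D, z.1 ∈ S → ∀ a, C + φ z ≤ actionValue p lam φ z a) (t : ℕ) :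
    C + expectedPotential p lam z₀ g φ t - expectedPotential p lam z₀ g φ (t + 1) ≤
      expectedCost p lam z₀ g t := by
  have h1 := expectedCost_add_expectedPotential z₀ g hp hlam (hS hz) φ t
  have h2 : ∑ o, historyProb p lam z₀ g t o * (C + φ (historyState p lam z₀ g t o)) ≤
      ∑ o, historyProb p lam z₀ g t o *
        actionValue p lam φ (historyState p lam z₀ g t o) (g t o) :=
    Finset.sum_le_sum fun o _ => by
      by_cases ho : historyProb p lam z₀ g t o = 0
      · simp [ho]
      · exact mul_le_mul_of_nonneg_left
          (hφ _ (historyState_mem z₀ g hp hlam hS hclosed hz t o ho) _)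
          (historyProb_nonneg z₀ g hp hlam (hS hz) t o)
  simp only [mul_add, Finset.sum_add_distrib, ← Finset.sum_mul,
    sum_historyProb z₀ g hp hlam hB (hS hz), one_mul] at h2
  change C + expectedPotential p lam z₀ g φ t ≤ _ at h2
  linarith

include hp hlam hS hclosed hz in
theorem expectedCost_eq_of_solution (hB : 1 ≤ B) {φ : BeliefState B D → ℝ} {C : ℝ}
    (hφ : ∀ (t : ℕ) (o : Fin (t + 1) → Obs B D), (historyState p lam z₀ g t o).1 ∈ S →
      actionValue p lam φ (historyState p lam z₀ g t o) (g t o) =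
        C + φ (historyState p lam z₀ g t o)) (t : ℕ) :
    expectedCost p lam z₀ g t =
      C + expectedPotential p lam z₀ g φ t - expectedPotential p lam z₀ g φ (t + 1) := by
  have h1 := expectedCost_add_expectedPotential z₀ g hp hlam (hS hz) φ t
  have h2 : ∑ o, historyProb p lam z₀ g t o *
        actionValue p lam φ (historyState p lam z₀ g t o) (g t o) =
      ∑ o, historyProb p lam z₀ g t o * (C + φ (historyState p lam z₀ g t o)) :=
    Finset.sum_congr rfl fun o _ => by
      by_cases ho : historyProb p lam z₀ g t o = 0
      · simp [ho]
      · rw [hφ t o (historyState_mem z₀ g hp hlam hS hclosed hz t o ho)]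
  simp only [mul_add, Finset.sum_add_distrib, ← Finset.sum_mul,
    sum_historyProb z₀ g hp hlam hB (hS hz), one_mul] at h2
  change _ = C + expectedPotential p lam z₀ g φ t at h2
  linarith

theorem sum_range_telescope (C : ℝ) (E : ℕ → ℝ) (T : ℕ) :
    ∑ t ∈ Finset.range T, (C + E t - E (t + 1)) = T * C + (E 0 - E T) := by
  induction T with
  | zero => simp
  | succ T ih => rw [Finset.sum_range_succ, ih]; push_cast; ring

theorem tendsto_average_telescope (C : ℝ) {E : ℕ → ℝ} {K : ℝ} (hE : ∀ t, |E t| ≤ K) :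
    Tendsto (fun T : ℕ => (1 / (T : ℝ)) * ∑ t ∈ Finset.range T, (C + E t - E (t + 1))) atTop
      (𝓝 C) := by
  have h1 : Tendsto (fun T : ℕ => (1 / (T : ℝ)) * (E 0 - E T)) atTop (𝓝 0) := by
    refine tendsto_one_div_atTop_nhds_zero_nat.zero_mul_isBoundedUnder_le ?_
    refine isBoundedUnder_of ⟨K + K, fun T => ?_⟩
    exact (abs_sub _ _).trans (add_le_add (hE 0) (hE T))
  have h2 := h1.const_add C
  rw [add_zero] at h2
  refine h2.congr' ?_
  filter_upwards [eventually_gt_atTop 0] with T hT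
  have : (T : ℝ) ≠ 0 := by positivity
  rw [sum_range_telescope]
  field_simp

include hp hlam hS hclosed hz in
/-- A bounded supersolution of the Bellman equation bounds the average cost of every policy from
below. -/
theorem le_liminf_averageCost (hB : 1 ≤ B) {φ : BeliefState B D → ℝ} {C : ℝ}
    (hb : BoundedOn S φ)
    (hφ : ∀ z : BeliefState B D, z.1 ∈ S → ∀ a, C + φ z ≤ actionValue p lam φ z a) :
    C ≤ liminf (averageCost p lam z₀ g) atTop := by
  obtain ⟨K, hK⟩ := hb
  have hlim := tendsto_average_telescope C
    (abs_expectedPotential_le z₀ g hp hlam hS hclosed hz hB hK)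
  rw [← hlim.liminf_eq]
  refine liminf_le_liminf (Eventually.of_forall fun T => ?_) hlim.isBoundedUnder_ge ?_
  · exact mul_le_mul_of_nonneg_left (Finset.sum_le_sum fun t _ =>
      expectedCost_ge_of_supersolution z₀ g hp hlam hS hclosed hz hB hφ t) (by positivity)
  -- Comparing real-valued liminfs requires the larger sequence not to escape to infinity; the cost
  -- bound `D` ensures this.
  · refine (isBoundedUnder_of ⟨(D : ℝ), fun T => ?_⟩ :
      IsBoundedUnder (· ≤ ·) atTop (averageCost p lam z₀ g)).isCoboundedUnder_ge
    have h1 : ∑ t ∈ Finset.range T, expectedCost p lam z₀ g t ≤ T * D := by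
      refine (Finset.sum_le_card_nsmul _ _ (D : ℝ) fun t _ =>
        expectedCost_le z₀ g hp hlam hB (hS hz) t).trans ?_
      simp
    rcases Nat.eq_zero_or_pos T with rfl | hT
    · simp [averageCost]
    · have hT' : (0 : ℝ) < T := by positivity
      rw [averageCost, one_div, inv_mul_le_iff₀ hT']
      exact h1

include hp hlam hS hclosed hz in
/-- A policy that attains equality in the Bellman equation along its histories has average
cost `C`. -/
theorem tendsto_averageCost (hB : 1 ≤ B) {φ : BeliefState B D → ℝ} {C : ℝ}
    (hb : BoundedOn S φ)
    (hφ : ∀ (t : ℕ) (o : Fin (t + 1) → Obs B D), (historyState p lam z₀ g t o).1 ∈ S →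
      actionValue p lam φ (historyState p lam z₀ g t o) (g t o) =
        C + φ (historyState p lam z₀ g t o)) :
    Tendsto (averageCost p lam z₀ g) atTop (𝓝 C) := by
  obtain ⟨K, hK⟩ := hb
  refine (tendsto_average_telescope C
    (abs_expectedPotential_le z₀ g hp hlam hS hclosed hz hB hK)).congr fun T => ?_
  simp only [averageCost]
  congr 1
  exact Finset.sum_congr rfl fun t _ =>
    (expectedCost_eq_of_solution z₀ g hp hlam hS hclosed hz hB hφ t).symm

end

/-! ### Optimality for `D ≥ 2` and for `D = 1`. -/

/-- A policy that minimizes `Q` for a bounded solution of the Bellman equation is optimal when the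
age distinguishes success from failure. -/
theorem isOptimalFrom_of_two_le (hB : 1 ≤ B) (hD : 2 ≤ D) (hp : p ∈ Set.Icc (0 : ℝ) 1)
    (hlam : lam ∈ Set.Icc (0 : ℝ) 1) {S : Set (Belief B)} (hS : IsBeliefSpace lam S) {C : ℝ}
    {h : BeliefState B D → ℝ} (hb : BoundedOn S h) (hh : SolvesBellman p lam S C h)
    {π : BeliefState B D → Action}
    (hπ : ∀ z : BeliefState B D, z.1 ∈ S → ∀ a, Q p lam h z (π z) ≤ Q p lam h z a)
    {z₀ : BeliefState B D} (hz : z₀.1 ∈ S) : IsOptimalFrom p lam z₀ π C := by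
  have hclosed : ∀ z : BeliefState B D, z.1 ∈ S → ∀ a o', obsProb p lam z a o' ≠ 0 →
      bayesUpdate p lam z a o' ∈ S := fun z hz a o' ho => bayesUpdate_mem hD hS hz a o' ho
  have hcases : ∀ a : Action, a = 0 ∨ a = 1 := fun a => by fin_cases a <;> simp
  refine ⟨?_, fun g => ?_⟩
  · refine tendsto_averageCost z₀ _ hp hlam hS.1 hclosed hz hB hb fun t o ho => ?_
    -- The beliefs used by the policy are the posteriors under its own law, so its action is `π` at
    -- the filtered belief-state.
    have e : beliefPolicy p lam z₀ π t o =
        π (historyState p lam z₀ (beliefPolicy p lam z₀ π) t o) := by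
      rw [historyState, trajProb_beliefPolicy]; rfl
    set z := historyState p lam z₀ (beliefPolicy p lam z₀ π) t o
    rw [e, actionValue_eq_Q hB hD h (hS.1 ho).2, hh z ho]
    refine le_antisymm (le_min (hπ z ho 0) (hπ z ho 1)) ?_
    rcases hcases (π z) with h0 | h1
    · rw [h0]; exact min_le_left _ _
    · rw [h1]; exact min_le_right _ _
  · refine le_liminf_averageCost z₀ g hp hlam hS.1 hclosed hz hB hb fun z hz a => ?_
    rw [actionValue_eq_Q hB hD h (hS.1 hz).2, hh z hz]
    rcases hcases a with rfl | rfl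
    · exact min_le_left _ _
    · exact min_le_right _ _

theorem boundedOn_request (S : Set (Belief B)) :
    BoundedOn (D := D) S fun z => ((z.2.1 : ℕ) : ℝ) := by
  refine ⟨1, fun z _ => ?_⟩
  change |((z.2.1 : ℕ) : ℝ)| ≤ 1
  rw [abs_of_nonneg (Nat.cast_nonneg _)]
  have : (z.2.1 : ℕ) ≤ 1 := by omega
  exact_mod_cast this

theorem solvesBellman_of_age_one (hD : D = 1) {S : Set (Belief B)} (hS : IsBeliefSpace lam S) :
    SolvesBellman (D := D) p lam S p fun z => ((z.2.1 : ℕ) : ℝ) := fun z hz => by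
  rw [Q_of_age_one hD (hS.1 hz).2, Q_of_age_one hD (hS.1 hz).2, min_self]

/-- If the age is always `1`, every policy has the average cost `p`. -/
theorem isOptimalFrom_of_age_one (hB : 1 ≤ B) (hD : D = 1) (hp : p ∈ Set.Icc (0 : ℝ) 1)
    (hlam : lam ∈ Set.Icc (0 : ℝ) 1) (π : BeliefState B D → Action)
    {z₀ : BeliefState B D} (hz : z₀.1 ∈ stdSimplex ℝ (Fin (B + 1))) :
    IsOptimalFrom p lam z₀ π p := by
  have hclosed : ∀ z : BeliefState B D, z.1 ∈ stdSimplex ℝ (Fin (B + 1)) → ∀ a o',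
      obsProb p lam z a o' ≠ 0 → bayesUpdate p lam z a o' ∈ stdSimplex ℝ (Fin (B + 1)) :=
    fun z hz a o' ho => bayesUpdate_mem_stdSimplex hp hlam hz a o' ho
  exact ⟨tendsto_averageCost z₀ _ hp hlam subset_rfl hclosed hz hB (boundedOn_request _)
      fun t o ho => actionValue_of_age_one hB hD ho.2 _,
    fun g => le_liminf_averageCost z₀ g hp hlam subset_rfl hclosed hz hB (boundedOn_request _)
      fun z hz a => (actionValue_of_age_one hB hD hz.2 a).ge⟩

end AoI

theorem theorem1 (B D : ℕ) (hB : 1 ≤ B) (hD : 1 ≤ D) (p lam : ℝ)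
    (hp : p ∈ Set.Icc (0 : ℝ) 1) (hlam : lam ∈ Set.Icc (0 : ℝ) 1) :
    -- for `D ≥ 2`, the explicit `Q` is the action-value function of the belief-state MDP
    (2 ≤ D → ∀ (h : AoI.BeliefState B D → ℝ) (z : AoI.BeliefState B D) (a : AoI.Action),
      z.1 ∈ stdSimplex ℝ (Fin (B + 1)) → AoI.actionValue p lam h z a = AoI.Q p lam h z a) ∧
    -- one constant serves all belief spaces and all initial belief-states
    ∃ Cstar : ℝ, ∀ S : Set (AoI.Belief B), AoI.IsBeliefSpace lam S →
      (∃ h : AoI.BeliefState B D → ℝ, AoI.BoundedOn S h ∧ AoI.SolvesBellman p lam S Cstar h) ∧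
      ∀ (C : ℝ) (h : AoI.BeliefState B D → ℝ),
        AoI.BoundedOn S h → AoI.SolvesBellman p lam S C h →
        C = Cstar ∧
        ∀ π : AoI.BeliefState B D → AoI.Action,
          (∀ z : AoI.BeliefState B D, z.1 ∈ S →
            ∀ a : AoI.Action, AoI.Q p lam h z (π z) ≤ AoI.Q p lam h z a) →
          ∀ z₀ : AoI.BeliefState B D, z₀.1 ∈ S → AoI.IsOptimalFrom p lam z₀ π Cstar := by
  refine ⟨fun hD2 h z a hz => AoI.actionValue_eq_Q hB hD2 h hz.2 a, ?_⟩
  obtain ⟨C₀, h₀, ⟨K, hK⟩, hsol⟩ := AoI.exists_solvesBellman hB hD hp hlam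
  refine ⟨C₀, fun S hS => ?_⟩
  have hb₀ : AoI.BoundedOn S h₀ := ⟨K, fun z hz => hK z (hS.1 hz)⟩
  have hsol₀ : AoI.SolvesBellman p lam S C₀ h₀ := fun z hz => hsol z (hS.1 hz)
  refine ⟨⟨h₀, hb₀, hsol₀⟩, fun C h hb hh => ?_⟩
  have hC : C = C₀ := hh.const_unique hB hD hp hS hb hb₀ hsol₀
  refine ⟨hC, fun π hπ z₀ hz => ?_⟩
  rcases hD.eq_or_lt with h1 | h2
  -- The explicit solution `h = r` with constant `p` identifies the common constant.
  · have hp₀ : p = C₀ := (AoI.solvesBellman_of_age_one h1.symm hS).const_unique hB hD hp hS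
      (AoI.boundedOn_request S) hb₀ hsol₀
    rw [← hp₀]
    exact AoI.isOptimalFrom_of_age_one hB h1.symm hp hlam π (hS.1 hz)
  · rw [← hC]
    exact AoI.isOptimalFrom_of_two_le hB h2 hp hlam hS hb hh hπ hz
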